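/- Let $k$ and $\alpha$ be integers with $4 \le \alpha < 2k$. There is a finite connected graph $G$ with positive edge weights whose treewidth is exactly $\alpha$, together with an initial placement of $k$ servers at distinct vertices of $G$, such that the following holds for the $k$-server problem on the shortest-path metric of $G$. A deterministic online algorithm with advice sees the requests one at a time and has access to an infinite tape of bits; after each request it may read further bits of the tape, and its server configuration after serving a request depends only on the requests seen so far and on the bits read so far. Let $n \ge 4k$, let $b$ be a nonnegative integer, and suppose that for every request sequence $\sigma$ of length $n$ there is a tape with which the algorithm serves $\sigma$ at the optimal offline cost while reading at most $b$ bits. Then $$b \;\ge\; \frac n2\,\bigl(\log_2 \alpha - 1.22\bigr).$$ Here the treewidth of $G$ is the minimum, over all tree decompositions of $G$, of the maximum bag size minus one, and the cost is the total distance moved by all servers. -/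

import Mathlib

/-! ### Tree decompositions and treewidth -/

/-- A tree decomposition of a graph `G`: a finite tree with a bag of vertices at every node, such
that the bags cover the vertices and the edges, and every bag on the tree path between the nodes
`i` and `j` contains the intersection of the bags at `i` and `j`. -/
structure TreeDecomposition {V : Type} (G : SimpleGraph V) where
  /-- the nodes of the tree -/
  Node : Type
  finite_node : Finite Node
  tree : SimpleGraph Node
  isTree : tree.IsTree
  bag : Node → Finset V
  cover_vertex : ∀ v : V, ∃ i, v ∈ bag i
  cover_edge : ∀ v w : V, G.Adj v w → ∃ i, v ∈ bag i ∧ w ∈ bag i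
  path_inter : ∀ (i j : Node) (p : tree.Walk i j), p.IsPath → ∀ l ∈ p.support,
    ∀ v, v ∈ bag i → v ∈ bag j → v ∈ bag l

/-- The decomposition has width `a`: the largest bag has exactly `a + 1` elements. -/
def TreeDecomposition.HasWidth {V : Type} {G : SimpleGraph V} (D : TreeDecomposition G)
    (a : ℕ) : Prop :=
  (∀ i, (D.bag i).card ≤ a + 1) ∧ ∃ i, (D.bag i).card = a + 1

/-- The treewidth of a (nonempty, finite) graph: the minimum width of a tree decomposition. -/
noncomputable def SimpleGraph.treewidth {V : Type} (G : SimpleGraph V) : ℕ :=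
  sInf {a : ℕ | ∃ D : TreeDecomposition G, D.HasWidth a}

/-! ### Metric spaces modelled by weighted graphs -/

/-- A connected undirected graph with positive edge weights. -/
structure WeightedGraph (V : Type) where
  graph : SimpleGraph V
  connected : graph.Connected
  weight : Sym2 V → ℝ
  weight_pos : ∀ e ∈ graph.edgeSet, 0 < weight e

namespace WeightedGraph

/-- The length of a walk: the sum of the weights of its edges. -/
def walkLength {V : Type} (M : WeightedGraph V) {u v : V} (p : M.graph.Walk u v) : ℝ :=
  (p.edges.map M.weight).sum

/-- The shortest-path metric. -/
noncomputable def distance {V : Type} (M : WeightedGraph V) (u v : V) : ℝ :=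
  ⨅ p : M.graph.Walk u v, M.walkLength p

end WeightedGraph

/-! ### The k-server problem -/

/-- `C t j` is the position of server `j` after the first `t` requests. The sequence of
configurations `C` serves the requests `σ` from the initial configuration `s₀`. -/
def IsKServerSchedule {V : Type} {k : ℕ} (s₀ : Fin k → V) (σ : List V)
    (C : ℕ → Fin k → V) : Prop :=
  C 0 = s₀ ∧ ∀ (t : ℕ) (ht : t < σ.length), ∃ j, C (t + 1) j = σ[t]

/-- The total distance moved by all servers over the first `n` requests. -/
noncomputable def kServerCost {V : Type} {k : ℕ} (M : WeightedGraph V) (n : ℕ)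
    (C : ℕ → Fin k → V) : ℝ :=
  ∑ t ∈ Finset.range n, ∑ j, M.distance (C t j) (C (t + 1) j)

/-- `C` serves `σ` and no (offline) way of serving `σ` has a smaller cost. -/
def IsOptimalSchedule {V : Type} {k : ℕ} (M : WeightedGraph V) (s₀ : Fin k → V) (σ : List V)
    (C : ℕ → Fin k → V) : Prop :=
  IsKServerSchedule s₀ σ C ∧
    ∀ C' : ℕ → Fin k → V, IsKServerSchedule s₀ σ C' →
      kServerCost M σ.length C ≤ kServerCost M σ.length C'

/-! ### Online algorithms with an advice tape -/

/-- A deterministic online algorithm for `k` servers with an (infinite) advice tape of bits.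
After the requests `l = [r₁, …, rₜ]` have arrived, the algorithm has read the first `bitsRead φ l`
bits of the tape `φ` and puts its servers on the positions `config φ l`. What it does
depends only on the requests that have arrived and on the bits it has read. -/
structure OnlineAlgorithm (V : Type) (k : ℕ) where
  config : (ℕ → Bool) → List V → Fin k → V
  bitsRead : (ℕ → Bool) → List V → ℕ
  bitsRead_mono : ∀ (φ : ℕ → Bool) (l : List V) (r : V), bitsRead φ l ≤ bitsRead φ (l ++ [r])
  depends_on_read : ∀ (φ ψ : ℕ → Bool) (l : List V), (∀ i < bitsRead φ l, ψ i = φ i) →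
    config ψ l = config φ l ∧ bitsRead ψ l = bitsRead φ l

namespace OnlineAlgorithm

/-- The configurations through which the algorithm goes on the requests `σ`, with the tape `φ`,
when the servers start in `s₀`. -/
def run {V : Type} {k : ℕ} (A : OnlineAlgorithm V k) (s₀ : Fin k → V) (φ : ℕ → Bool)
    (σ : List V) (t : ℕ) : Fin k → V :=
  if t = 0 then s₀ else A.config φ (σ.take t)

/-- For every request sequence of length `n` there is an advice tape with which the algorithm
serves the sequence optimally and reads at most `b` bits. -/
def IsOptimalWithAdvice {V : Type} {k : ℕ} (A : OnlineAlgorithm V k) (M : WeightedGraph V)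
    (s₀ : Fin k → V) (n b : ℕ) : Prop :=
  ∀ σ : List V, σ.length = n →
    ∃ φ : ℕ → Bool, IsOptimalSchedule M s₀ σ (A.run s₀ φ σ) ∧ A.bitsRead φ σ ≤ b

end OnlineAlgorithm

/-! The metric forces every optimal schedule to follow permutations that are revealed one request
too late, so the advice must spell them out.

Let `m = ⌊(α + 1) / 2⌋`. The graph is a clique of `α + 1` hubs together with request sites, each
adjacent to at most `m + 1 ≤ α` hubs. A star decomposition and
`TreeDecomposition.exists_clique_subset_bag` give treewidth `α`. Each label `s < m` owns the hubs
`2s` and `2s + 1`, one for each parity of the layer. In a phase governed by a permutation `ρ`,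
request `o` has a cheap edge to its own label hub and doors to the previous phase's hubs of the
labels `ρ o, ρ (o + 1), …, ρ (m - 1)`. A server with label `s` gets there at the base price exactly
if door `s` is still open, and the only way to serve the whole phase at the base price is to send
server `ρ o` to request `o`. Unless `o` is last, request `o` does not tell which of its doors is `ρ
o`; only request `o + 1` does, by closing it.

Door weights drop by 2 per layer, so that leaving through a door of the source costs more than
entering through a door of the target. After `r` such phases a home phase without doors resets the
layer. It also requests the parked sites, whose edges are so long that moving a parked server never
pays off.

Optimality is certified by linear programming duality. A schedule amounts to an injective choice of
a predecessor for each request; the dual variables `y` (targets) and `z ≥ 0` (sources) satisfy `y -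
z ≤ distance`. By complementary slackness, `distance_predServed_eq_of_isOptimalSchedule`, optimal
schedules use tight pairs only, and `targetValue_sub_lt` shows that pairs without an open door are
not tight. Hence `b` bits determine all permutations (`perm_eq_of_advice_eq`), and `m! ^ I ≤ 2 ^ b`,
where `I` counts the phases that are not home phases. With `r = 2000 k` the home phases hardly
matter, `I` is about `n / m`, and numerical estimates of `log m!` finish the proof. -/

/-! ### Cliques in tree decompositions -/

/-- In a tree decomposition every clique is contained in a single bag. -/
theorem TreeDecomposition.exists_clique_subset_bag {V : Type} {G : SimpleGraph V}
    (D : TreeDecomposition G) (K : Finset V) (hK : ∀ u ∈ K, ∀ v ∈ K, u ≠ v → G.Adj u v) :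
    ∃ i, K ⊆ D.bag i := by
  classical
  have := D.finite_node
  have : Nonempty D.Node := D.isTree.connected.nonempty
  -- If a bag with largest trace on `K` misses `v ∈ K`, the node `s` nearest to `t` whose bag
  -- contains `v` does strictly better: paths from `t` to nodes containing `v` all enter through
  -- `s`.
  obtain ⟨t, ht⟩ := Finite.exists_max (fun i => (K ∩ D.bag i).card)
  refine ⟨t, fun v hv => ?_⟩
  by_contra hvt
  obtain ⟨i₀, hi₀⟩ := D.cover_vertex v
  obtain ⟨⟨s, hs⟩, -, hmin⟩ := WellFounded.has_min
    (r := fun a b : {i // v ∈ D.bag i} => D.tree.dist t a < D.tree.dist t b)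
    (InvImage.wf (fun a : {i // v ∈ D.bag i} => D.tree.dist t a) Nat.lt_wfRel.wf)
    Set.univ ⟨⟨i₀, hi₀⟩, trivial⟩
  obtain ⟨p, hp, hpl⟩ : ∃ p : D.tree.Walk t s, p.IsPath ∧ p.length = D.tree.dist t s := by
    obtain ⟨p, hp⟩ := D.isTree.connected.exists_walk_length_eq_dist t s
    exact ⟨p, p.isPath_of_length_eq_dist hp, hp⟩
  have hgate : ∀ i, v ∈ D.bag i → ∀ u, u ∈ D.bag t → u ∈ D.bag i → u ∈ D.bag s := by
    intro i hi u hut hui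
    obtain ⟨q, hq, -⟩ := D.isTree.existsUnique_path s i
    -- All bags along `q` contain `v`, so a node of `p` other than `s` on `q` would contradict the
    -- minimality of `s`.
    have hpq : (p.append q).IsPath := by
      rw [SimpleGraph.Walk.isPath_def, SimpleGraph.Walk.support_append]
      refine List.Nodup.append hp.support_nodup
        (hq.support_nodup.sublist (List.tail_sublist _)) ?_
      intro x hxp hxq
      have hxs : x ≠ s := by
        rintro rfl
        have := hq.support_nodup
        rw [← SimpleGraph.Walk.cons_tail_support] at this
        exact (List.nodup_cons.1 this).1 hxq
      have hvx : v ∈ D.bag x := D.path_inter s i q hq x (List.mem_of_mem_tail hxq) v hs hi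
      refine hmin ⟨x, hvx⟩ trivial ?_
      have h1 : D.tree.dist t x ≤ (p.takeUntil x hxp).length := SimpleGraph.dist_le _
      have h2 := p.length_takeUntil_lt_length hxp hxs
      simp only
      omega
    exact D.path_inter t i _ hpq s (by simp) u hut hui
  have hsub : insert v (K ∩ D.bag t) ⊆ K ∩ D.bag s := by
    intro u hu
    rw [Finset.mem_insert, Finset.mem_inter] at hu
    rcases hu with rfl | ⟨huK, hut⟩
    · exact Finset.mem_inter.2 ⟨hv, hs⟩
    · refine Finset.mem_inter.2 ⟨huK, ?_⟩
      have huv : u ≠ v := fun h => hvt (h ▸ hut)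
      obtain ⟨i, hui, hvi⟩ := D.cover_edge u v (hK u huK v hv huv)
      exact hgate i hvi u hut hui
  have h1 := Finset.card_le_card hsub
  rw [Finset.card_insert_of_notMem (by simp [hvt])] at h1
  have := ht s
  omega

/-! ### Hub graphs -/

/-- The graph in which the hubs `Q` form a clique and every other vertex `x : X` is adjacent
to the hubs in `N x`. -/
def hubGraph {Q X : Type} (N : X → Finset Q) : SimpleGraph (Q ⊕ X) where
  Adj
    | Sum.inl u, Sum.inl v => u ≠ v
    | Sum.inl u, Sum.inr x => u ∈ N x
    | Sum.inr x, Sum.inl u => u ∈ N x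
    | Sum.inr _, Sum.inr _ => False
  symm := ⟨by
    rintro (u | x) (v | y) h
    · exact Ne.symm h
    · exact h
    · exact h
    · exact h⟩
  loopless := ⟨by
    rintro (u | x) h
    · exact h rfl
    · exact h⟩

theorem hubGraph_connected {Q X : Type} [Nonempty Q] (N : X → Finset Q)
    (hN : ∀ x, (N x).Nonempty) : (hubGraph N).Connected := by
  have hQ : ∀ u v : Q, (hubGraph N).Reachable (Sum.inl u) (Sum.inl v) := by
    intro u v
    by_cases h : u = v
    · rw [h]
    · exact SimpleGraph.Adj.reachable (show u ≠ v from h)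
  have hX : ∀ (w : Q ⊕ X) (v : Q), (hubGraph N).Reachable w (Sum.inl v) := by
    rintro (u | x) v
    · exact hQ u v
    · obtain ⟨u, hu⟩ := hN x
      exact (SimpleGraph.Adj.reachable
        (show (hubGraph N).Adj (Sum.inr x) (Sum.inl u) from hu)).trans (hQ u v)
  obtain ⟨u₀⟩ := ‹Nonempty Q›
  exact { preconnected := fun a b => (hX a u₀).trans (hX b u₀).symm
          nonempty := ⟨Sum.inl u₀⟩ }

theorem none_mem_support_of_starGraph_walk {X : Type} {x : X} {j : Option X}
    (p : (SimpleGraph.starGraph (none : Option X)).Walk (some x) j) (hj : some x ≠ j) :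
    none ∈ p.support := by
  cases p with
  | nil => exact absurd rfl hj
  | cons h q =>
    rw [SimpleGraph.starGraph_adj] at h
    rcases h.2 with h | h
    · exact absurd h (by simp)
    · subst h
      simp

/-- The tree decomposition of a hub graph: a star with the hubs in the centre. -/
noncomputable def hubDecomposition {Q X : Type} [Fintype Q] [DecidableEq Q] [DecidableEq X]
    [Finite X] (N : X → Finset Q) : TreeDecomposition (hubGraph N) where
  Node := Option X
  finite_node := inferInstance
  tree := SimpleGraph.starGraph none
  isTree := SimpleGraph.isTree_starGraph none
  bag
    | none => Finset.univ.image Sum.inl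
    | some x => insert (Sum.inr x) ((N x).image Sum.inl)
  cover_vertex := by
    rintro (u | x)
    · exact ⟨none, by simp⟩
    · exact ⟨some x, by simp⟩
  cover_edge := by
    rintro (u | x) (v | y) h
    · exact ⟨none, by simp⟩
    · exact ⟨some y, by simpa using (show u ∈ N y from h)⟩
    · exact ⟨some x, by simpa using (show v ∈ N x from h)⟩
    · exact absurd h id
  path_inter := by
    intro i j p hp l hl v hi hj
    by_cases hli : l = i
    · exact hli ▸ hi
    by_cases hlj : l = j
    · exact hlj ▸ hj
    cases l with
    | none =>
      rcases v with u | x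
      -- A hub lies in the central bag; a site lies in the bag of a single leaf, so `i = j` and the
      -- path never reaches the centre.
      · simp
      · have hix : i = some x := by
          cases i with
          | none => simp at hi
          | some y => simp at hi; rw [hi]
        have hjx : j = some x := by
          cases j with
          | none => simp at hj
          | some y => simp at hj; rw [hj]
        subst hix; subst hjx
        rw [SimpleGraph.Walk.isPath_iff_nil] at hp
        rw [SimpleGraph.Walk.nil_iff_support_eq.1 hp] at hl
        simp at hl
    | some x =>
      -- A leaf in the interior of a path would force the centre to be visited both before and after
      -- it.
      exfalso
      obtain ⟨q, r, -, -, rfl⟩ := hp.mem_support_iff_exists_append.1 hl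
      have h1 := none_mem_support_of_starGraph_walk q.reverse hli
      have h2 := none_mem_support_of_starGraph_walk r hlj
      rw [SimpleGraph.Walk.support_reverse, List.mem_reverse] at h1
      exact SimpleGraph.Walk.IsPath.ne_of_mem_support_of_append hp (by simp) h1 h2 rfl

theorem hubGraph_treewidth {Q X : Type} [Fintype Q] [Finite X] (N : X → Finset Q) (a : ℕ)
    (hQ : Fintype.card Q = a + 1) (hN : ∀ x, (N x).card ≤ a) : (hubGraph N).treewidth = a := by
  classical
  have hcard : (Finset.univ.image (Sum.inl : Q → Q ⊕ X)).card = a + 1 := by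
    rw [Finset.card_image_of_injective _ Sum.inl_injective, Finset.card_univ, hQ]
  refine le_antisymm (Nat.sInf_le ⟨hubDecomposition N, ?_, none, hcard⟩) ?_
  · rintro (_ | x)
    · exact hcard.le
    · exact (Finset.card_insert_le _ _).trans
        (Nat.succ_le_succ (Finset.card_image_le.trans (hN x)))
  · refine le_csInf ⟨a, hubDecomposition N, ?_, none, hcard⟩ ?_
    · rintro (_ | x)
      · exact hcard.le
      · exact (Finset.card_insert_le _ _).trans
          (Nat.succ_le_succ (Finset.card_image_le.trans (hN x)))
    · rintro c ⟨D, hD, -⟩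
      obtain ⟨i, hi⟩ := D.exists_clique_subset_bag (Finset.univ.image Sum.inl) (by
        intro u hu v hv huv
        simp only [Finset.mem_image, Finset.mem_univ, true_and] at hu hv
        obtain ⟨u, rfl⟩ := hu
        obtain ⟨v, rfl⟩ := hv
        exact fun h => huv (congrArg _ h))
      have := (Finset.card_le_card hi).trans (hD i)
      omega

/-! ### The shortest-path metric -/

namespace WeightedGraph

variable {V : Type} (M : WeightedGraph V)

theorem walkLength_cons {u v w : V} (h : M.graph.Adj u v) (p : M.graph.Walk v w) :
    M.walkLength (SimpleGraph.Walk.cons h p) = M.weight s(u, v) + M.walkLength p := by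
  simp [walkLength]

theorem walkLength_append {u v w : V} (p : M.graph.Walk u v) (q : M.graph.Walk v w) :
    M.walkLength (p.append q) = M.walkLength p + M.walkLength q := by
  simp [walkLength]

theorem walkLength_nonneg {u v : V} (p : M.graph.Walk u v) : 0 ≤ M.walkLength p := by
  refine List.sum_nonneg ?_
  intro x hx
  obtain ⟨e, he, rfl⟩ := List.mem_map.1 hx
  exact (M.weight_pos e (p.edges_subset_edgeSet he)).le

theorem bddBelow_walkLength (u v : V) :
    BddBelow (Set.range fun p : M.graph.Walk u v => M.walkLength p) :=
  ⟨0, by rintro _ ⟨p, rfl⟩; exact M.walkLength_nonneg p⟩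

theorem distance_le_walkLength {u v : V} (p : M.graph.Walk u v) :
    M.distance u v ≤ M.walkLength p :=
  ciInf_le (M.bddBelow_walkLength u v) p

theorem le_distance {u v : V} {c : ℝ} (h : ∀ p : M.graph.Walk u v, c ≤ M.walkLength p) :
    c ≤ M.distance u v := by
  have : Nonempty (M.graph.Walk u v) := M.connected.preconnected u v
  exact le_ciInf h

theorem distance_nonneg (u v : V) : 0 ≤ M.distance u v :=
  M.le_distance M.walkLength_nonneg

theorem distance_self (u : V) : M.distance u u = 0 :=
  le_antisymm (M.distance_le_walkLength (SimpleGraph.Walk.nil : M.graph.Walk u u))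
    (M.distance_nonneg u u)

theorem distance_triangle (u v w : V) :
    M.distance u w ≤ M.distance u v + M.distance v w := by
  rw [← sub_le_iff_le_add]
  refine M.le_distance fun q => ?_
  rw [sub_le_iff_le_add', ← sub_le_iff_le_add]
  refine M.le_distance fun p => ?_
  have h := M.distance_le_walkLength (q.append p)
  rw [walkLength_append] at h
  linarith

end WeightedGraph

/-! ### The metric of a weighted hub graph -/

/-- Edges between hubs have weight `B`, the edge between `x` and the hub `u` has weight `e x u`. -/
noncomputable def hubWeight {Q X : Type} (e : X → Q → ℝ) (B : ℝ) : Sym2 (Q ⊕ X) → ℝ :=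
  Sym2.lift ⟨fun a b => match a, b with
    | Sum.inl _, Sum.inl _ => B
    | Sum.inl u, Sum.inr x => e x u
    | Sum.inr x, Sum.inl u => e x u
    | Sum.inr _, Sum.inr _ => B, by rintro (u | x) (v | y) <;> rfl⟩

/-- The weighted hub graph. -/
noncomputable def weightedHubGraph {Q X : Type} [Nonempty Q] (N : X → Finset Q)
    (hN : ∀ x, (N x).Nonempty) (e : X → Q → ℝ) (B : ℝ) (he : ∀ x u, 0 < e x u) (hB : 0 < B) :
    WeightedGraph (Q ⊕ X) where
  graph := hubGraph N
  connected := hubGraph_connected N hN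
  weight := hubWeight e B
  weight_pos := by
    intro s _
    induction s with
    | _ a b =>
      rcases a with u | x <;> rcases b with v | y <;> simp [hubWeight, he, hB]

section

variable {Q X : Type} [Nonempty Q] {N : X → Finset Q} {hN : ∀ x, (N x).Nonempty} {e : X → Q → ℝ}
  {B : ℝ} {he : ∀ x u, 0 < e x u} {hB : 0 < B}

theorem distance_weightedHubGraph_le {x y : X} {u : Q} (hx : u ∈ N x) (hy : u ∈ N y) :
    (weightedHubGraph N hN e B he hB).distance (Sum.inr x) (Sum.inr y) ≤ e x u + e y u := by
  have h1 : (weightedHubGraph N hN e B he hB).graph.Adj (Sum.inr x) (Sum.inl u) := hx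
  have h2 : (weightedHubGraph N hN e B he hB).graph.Adj (Sum.inl u) (Sum.inr y) := hy
  refine (WeightedGraph.distance_le_walkLength _
    (SimpleGraph.Walk.cons h1 (SimpleGraph.Walk.cons h2 SimpleGraph.Walk.nil))).trans ?_
  rw [WeightedGraph.walkLength_cons, WeightedGraph.walkLength_cons]
  exact le_of_eq (congrArg _ (add_zero _))

/-- The length of a walk to `y` is bounded below through a pseudometric on the hubs that is
dominated by the lengths of the detours. -/
theorem walkLength_weightedHubGraph_ge (δ : Q → Q → ℝ) (hself : ∀ u, δ u u = 0)
    (htri : ∀ u v w, δ u w ≤ δ u v + δ v w) (hδB : ∀ u v, δ u v ≤ B)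
    (hδe : ∀ x, ∀ u ∈ N x, ∀ v ∈ N x, δ u v ≤ e x u + e x v) (y : X) {a b : Q ⊕ X}
    (p : (weightedHubGraph N hN e B he hB).graph.Walk a b) (hb : b = Sum.inr y) :
    (∀ u, a = Sum.inl u → ∃ v ∈ N y, δ u v + e y v ≤
      (weightedHubGraph N hN e B he hB).walkLength p) ∧
    (∀ x, a = Sum.inr x → x ≠ y → ∃ u ∈ N x, ∃ v ∈ N y, e x u + δ u v + e y v ≤
      (weightedHubGraph N hN e B he hB).walkLength p) := by
  induction p with
  | nil =>
    subst hb
    refine ⟨fun u h => by simp at h, fun x h hxy => absurd (Sum.inr_injective h).symm hxy⟩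
  | cons h p ih =>
    rename_i a a' c
    obtain ⟨ih1, ih2⟩ := ih hb
    rw [WeightedGraph.walkLength_cons]
    refine ⟨?_, ?_⟩
    · rintro u rfl
      rcases a' with u' | x
      · obtain ⟨v, hv, hle⟩ := ih1 u' rfl
        refine ⟨v, hv, ?_⟩
        have hw : (weightedHubGraph N hN e B he hB).weight s(Sum.inl u, Sum.inl u') = B := rfl
        have := htri u u' v
        have := hδB u u'
        rw [hw]; linarith
      · have hux : u ∈ N x := h
        have hw : (weightedHubGraph N hN e B he hB).weight s(Sum.inl u, Sum.inr x) = e x u := rfl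
        rw [hw]
        by_cases hxy : x = y
        · subst hxy
          refine ⟨u, hux, ?_⟩
          have := (weightedHubGraph N hN e B he hB).walkLength_nonneg p
          rw [hself]; linarith
        -- The detour `u, x, u'` costs at least `δ u u'`, so it can be replaced by a direct step
        -- between hubs.
        · obtain ⟨u', hu', v, hv, hle⟩ := ih2 x rfl hxy
          refine ⟨v, hv, ?_⟩
          have := htri u u' v
          have := hδe x u hux u' hu'
          linarith
    · rintro x rfl hxy
      rcases a' with u | x'
      · have hux : u ∈ N x := h
        have hw : (weightedHubGraph N hN e B he hB).weight s(Sum.inr x, Sum.inl u) = e x u := rfl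
        obtain ⟨v, hv, hle⟩ := ih1 u rfl
        refine ⟨u, hux, v, hv, ?_⟩
        rw [hw]; linarith
      · exact absurd h id

theorem le_distance_weightedHubGraph (δ : Q → Q → ℝ) (hself : ∀ u, δ u u = 0)
    (htri : ∀ u v w, δ u w ≤ δ u v + δ v w) (hδB : ∀ u v, δ u v ≤ B)
    (hδe : ∀ x, ∀ u ∈ N x, ∀ v ∈ N x, δ u v ≤ e x u + e x v) {x y : X} (hxy : x ≠ y) {c : ℝ}
    (hc : ∀ u ∈ N x, ∀ v ∈ N y, c ≤ e x u + δ u v + e y v) :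
    c ≤ (weightedHubGraph N hN e B he hB).distance (Sum.inr x) (Sum.inr y) := by
  refine WeightedGraph.le_distance _ fun p => ?_
  obtain ⟨u, hu, v, hv, h⟩ :=
    (walkLength_weightedHubGraph_ge δ hself htri hδB hδe y p rfl).2 x rfl hxy
  exact (hc u hu v hv).trans h

end

/-! ### Optimality of schedules by linear programming duality

Requests are numbered from `k` on; the indices below `k` stand for the initial positions. -/

/-- The index of the last request served by each server, when request `k + i` is served by the
server `f i`. -/
def lastServed {k : ℕ} (f : ℕ → Fin k) : ℕ → Fin k → ℕ
  | 0 => fun j => j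
  | t + 1 => Function.update (lastServed f t) (f t) (k + t)

/-- The index of the request served before request `k + t` by the same server. -/
def predServed {k : ℕ} (f : ℕ → Fin k) (t : ℕ) : ℕ := lastServed f t (f t)

section

variable {k : ℕ} (f : ℕ → Fin k)

theorem lastServed_lt (t : ℕ) (j : Fin k) : lastServed f t j < k + t := by
  induction t with
  | zero => simp [lastServed]
  | succ t ih =>
    rw [lastServed]
    by_cases h : j = f t
    · subst h; simp
    · rw [Function.update_of_ne h]; omega

theorem lastServed_injective (t : ℕ) : Function.Injective (lastServed f t) := by
  induction t with
  | zero => exact Fin.val_injective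
  | succ t ih =>
    intro i j hij
    rw [lastServed] at hij
    by_cases hi : i = f t <;> by_cases hj : j = f t
    · rw [hi, hj]
    · subst hi
      rw [Function.update_self, Function.update_of_ne hj] at hij
      have := lastServed_lt f t j
      omega
    · subst hj
      rw [Function.update_self, Function.update_of_ne hi] at hij
      have := lastServed_lt f t i
      omega
    · rw [Function.update_of_ne hi, Function.update_of_ne hj] at hij
      exact ih hij

theorem predServed_lt (t : ℕ) : predServed f t < k + t := lastServed_lt f t _

/-- An index that has been overwritten never comes back, because the indices written from then on
are larger. This makes predecessors injective. -/
theorem lastServed_ne_predServed {t t' : ℕ} (h : t < t') (j : Fin k) :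
    lastServed f t' j ≠ predServed f t := by
  induction t', h using Nat.le_induction generalizing j with
  | base =>
    rw [lastServed]
    by_cases hj : j = f t
    · subst hj
      rw [Function.update_self]
      exact (predServed_lt f t).ne'
    · rw [Function.update_of_ne hj]
      exact fun h => hj (lastServed_injective f t h)
  | succ t' ht ih =>
    rw [lastServed]
    by_cases hj : j = f t'
    · subst hj
      rw [Function.update_self]
      have := predServed_lt f t
      omega
    · rw [Function.update_of_ne hj]
      exact ih j

theorem predServed_injective : Function.Injective (predServed f) := by
  intro t t' h
  rcases lt_trichotomy t t' with hlt | heq | hlt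
  · exact absurd h.symm (lastServed_ne_predServed f hlt _)
  · exact heq
  · exact absurd h (lastServed_ne_predServed f hlt _)

theorem lastServed_congr {f g : ℕ → Fin k} (t : ℕ) (h : ∀ i < t, f i = g i) :
    lastServed f t = lastServed g t := by
  induction t with
  | zero => rfl
  | succ t ih =>
    rw [lastServed, lastServed, ih fun i hi => h i (by omega), h t (by omega)]

theorem predServed_congr {f g : ℕ → Fin k} (t : ℕ) (h : ∀ i ≤ t, f i = g i) :
    predServed f t = predServed g t := by
  rw [predServed, predServed, lastServed_congr t fun i hi => h i hi.le, h t le_rfl]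

/-- Summing a potential over the predecessors telescopes. -/
theorem sum_predServed (z : ℕ → ℝ) (t : ℕ) :
    ∑ i ∈ Finset.range t, z (predServed f i) + ∑ j, z (lastServed f t j) =
      ∑ j : Fin k, z j + ∑ i ∈ Finset.range t, z (k + i) := by
  induction t with
  | zero => simp [lastServed]
  | succ t ih =>
    have h : ∑ j, z (lastServed f (t + 1) j) =
        ∑ j, z (lastServed f t j) - z (predServed f t) + z (k + t) := by
      rw [← Finset.add_sum_erase _ _ (Finset.mem_univ (f t)),
        ← Finset.add_sum_erase (a := f t) _ (fun j => z (lastServed f t j)) (Finset.mem_univ (f t)),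
        Finset.sum_congr (g := fun j => z (lastServed f t j)) rfl]
      · rw [lastServed, Function.update_self, predServed]; ring
      · intro j hj
        rw [lastServed, Function.update_of_ne (Finset.ne_of_mem_erase hj)]
    rw [Finset.sum_range_succ, Finset.sum_range_succ, h]
    linarith

end

/-- The total cost of a schedule is at least the cost of moving the serving servers only. -/
theorem sum_distance_le_kServerCost {V : Type} {k : ℕ} (M : WeightedGraph V) (e : ℕ → V)
    (C : ℕ → Fin k → V) (f : ℕ → Fin k) (h0 : ∀ j : Fin k, C 0 j = e j) (n : ℕ)
    (hf : ∀ t < n, C (t + 1) (f t) = e (k + t)) :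
    ∑ i ∈ Finset.range n, M.distance (e (predServed f i)) (e (k + i)) +
      ∑ j, M.distance (e (lastServed f n j)) (C n j) ≤ kServerCost M n C := by
  induction n with
  | zero => simp [lastServed, h0, M.distance_self, kServerCost]
  | succ n ih =>
    have ih' := ih fun t ht => hf t (by omega)
    have hC : kServerCost M (n + 1) C = kServerCost M n C +
        ∑ j, M.distance (C n j) (C (n + 1) j) := by
      rw [kServerCost, Finset.sum_range_succ, kServerCost]
    -- The distance of each server from its last served request is a reserve of cost already paid;
    -- the serving server spends its reserve, the others enlarge theirs, both by the triangle
    -- inequality.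
    have key : M.distance (e (predServed f n)) (e (k + n)) +
        ∑ j, M.distance (e (lastServed f (n + 1) j)) (C (n + 1) j) ≤
        ∑ j, (M.distance (e (lastServed f n j)) (C n j) + M.distance (C n j) (C (n + 1) j)) := by
      rw [← Finset.add_sum_erase _ _ (Finset.mem_univ (f n)), ← add_assoc,
        ← Finset.add_sum_erase (a := f n) _
          (fun j => M.distance (e (lastServed f n j)) (C n j) + M.distance (C n j) (C (n + 1) j))
          (Finset.mem_univ (f n))]
      refine add_le_add ?_ (Finset.sum_le_sum fun j hj => ?_)
      · rw [lastServed, Function.update_self, hf n (by omega), M.distance_self, add_zero]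
        exact M.distance_triangle _ _ _
      · rw [lastServed, Function.update_of_ne (Finset.ne_of_mem_erase hj)]
        exact M.distance_triangle _ _ _
    rw [Finset.sum_add_distrib] at key
    rw [Finset.sum_range_succ, hC]
    linarith

/-- The cost of the schedule that moves the serving servers only. -/
theorem kServerCost_lastServed {V : Type} {k : ℕ} (M : WeightedGraph V) (e : ℕ → V)
    (f : ℕ → Fin k) (n : ℕ) :
    kServerCost M n (fun t j => e (lastServed f t j)) =
      ∑ i ∈ Finset.range n, M.distance (e (predServed f i)) (e (k + i)) := by
  refine Finset.sum_congr rfl fun t _ => ?_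
  have hsucc : lastServed f (t + 1) = Function.update (lastServed f t) (f t) (k + t) := rfl
  simp only [hsucc]
  rw [Finset.sum_eq_single (f t)]
  · rw [Function.update_self, predServed]
  · intro j _ hj
    rw [Function.update_of_ne hj, M.distance_self]
  · simp

/-- Any injective choice of predecessors is realized by servers. -/
theorem exists_predServed_eq {k : ℕ} [Nonempty (Fin k)] (n : ℕ) (p : ℕ → ℕ)
    (hlt : ∀ i < n, p i < k + i) (hinj : ∀ i < n, ∀ i' < n, p i = p i' → i = i') :
    ∃ f : ℕ → Fin k, ∀ i < n, predServed f i = p i := by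
  -- Request `t` goes to a server whose last index is `p t`. Such a server exists because every
  -- index not yet used as a predecessor is still held by some server (`hex`).
  let L : ℕ → Fin k → ℕ := fun t => Nat.rec (fun j => (j : ℕ))
    (fun t l => Function.update l (Classical.epsilon fun j => l j = p t) (k + t)) t
  let f : ℕ → Fin k := fun t => Classical.epsilon fun j => L t j = p t
  have hL : ∀ t, lastServed f t = L t := by
    intro t
    induction t with
    | zero => rfl
    | succ t ih => rw [lastServed, ih]
  have hex : ∀ t ≤ n, ∀ s < k + t, (∀ i < t, p i ≠ s) → ∃ j, L t j = s := by
    intro t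
    induction t with
    | zero => exact fun _ s hs _ => ⟨⟨s, hs⟩, rfl⟩
    | succ t ih =>
      intro ht s hs hp
      have hLt : L (t + 1) = Function.update (L t) (f t) (k + t) := rfl
      have hft : L t (f t) = p t := Classical.epsilon_spec
        (ih (by omega) (p t) (hlt t (by omega)) fun i hi h =>
          hi.ne (hinj i (by omega) t (by omega) h))
      rcases Nat.lt_succ_iff_lt_or_eq.1 hs with hs | rfl
      · obtain ⟨j, hj⟩ := ih (by omega) s hs fun i hi => hp i (by omega)
        refine ⟨j, ?_⟩
        rw [hLt, Function.update_of_ne, hj]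
        rintro rfl
        exact hp t (by omega) (hft.symm.trans hj)
      · exact ⟨f t, by rw [hLt, Function.update_self]; rfl⟩
  refine ⟨f, fun i hi => ?_⟩
  rw [predServed, hL]
  exact Classical.epsilon_spec (hex i hi.le (p i) (hlt i hi) fun i' hi' h =>
    hi'.ne (hinj i' (by omega) i hi h))

/-- Complementary slackness: given a dual solution `y`, `z` and predecessors `p` that attain its
value, every optimal schedule serves all requests tightly. -/
theorem distance_predServed_eq_of_isOptimalSchedule {V : Type} {k : ℕ} [Nonempty (Fin k)]
    (M : WeightedGraph V) (e : ℕ → V) (n : ℕ) (y z : ℕ → ℝ) (p : ℕ → ℕ)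
    (hyz : ∀ i < n, ∀ s < k + i, y i - z s ≤ M.distance (e s) (e (k + i)))
    (hlt : ∀ i < n, p i < k + i) (hinj : ∀ i < n, ∀ i' < n, p i = p i' → i = i')
    (hpd : ∀ i < n, M.distance (e (p i)) (e (k + i)) ≤ y i - z (p i))
    (hz : ∀ s < k + n, 0 ≤ z s) (hzp : ∀ s < k + n, z s ≠ 0 → ∃ i < n, p i = s)
    {s₀ : Fin k → V} (hs₀ : ∀ j : Fin k, s₀ j = e j) {σ : List V}
    (hσ : σ = List.ofFn fun t : Fin n => e (k + t)) {C : ℕ → Fin k → V}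
    (hC : IsOptimalSchedule M s₀ σ C) {f : ℕ → Fin k}
    (hf : ∀ t < n, C (t + 1) (f t) = e (k + t)) :
    ∀ i < n, M.distance (e (predServed f i)) (e (k + i)) = y i - z (predServed f i) := by
  have hlen : σ.length = n := by rw [hσ, List.length_ofFn]
  obtain ⟨g, hg⟩ := exists_predServed_eq n p hlt hinj
  -- An index with nonzero `z` is a predecessor in `g`, hence no longer held at the end.
  have hg0 : ∑ j, z (lastServed g n j) = 0 := by
    refine Finset.sum_eq_zero fun j _ => ?_
    by_contra h
    obtain ⟨i, hi, hpi⟩ := hzp _ (lastServed_lt g n j) h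
    exact lastServed_ne_predServed g hi j (by rw [hg i hi, hpi])
  have hf0 : 0 ≤ ∑ j, z (lastServed f n j) :=
    Finset.sum_nonneg fun j _ => hz _ (lastServed_lt f n j)
  have hopt : kServerCost M n C ≤ kServerCost M n (fun t j => e (lastServed g t j)) := by
    have := hC.2 (fun t j => e (lastServed g t j)) ⟨?_, ?_⟩
    · rwa [hlen] at this
    · funext j
      exact (hs₀ j).symm
    · intro t ht
      refine ⟨g t, ?_⟩
      subst hσ
      simp [lastServed]
  rw [kServerCost_lastServed] at hopt
  have hlow := sum_distance_le_kServerCost M e C f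
    (fun j => by rw [hC.1.1, hs₀]) n hf
  have hnn : 0 ≤ ∑ j, M.distance (e (lastServed f n j)) (C n j) :=
    Finset.sum_nonneg fun j _ => M.distance_nonneg _ _
  have hup : ∑ i ∈ Finset.range n, M.distance (e (predServed g i)) (e (k + i)) ≤
      ∑ i ∈ Finset.range n, (y i - z (predServed g i)) :=
    Finset.sum_le_sum fun i hi => by
      rw [Finset.mem_range] at hi
      rw [hg i hi]
      exact hpd i hi
  have h1 := sum_predServed f z n
  have h2 := sum_predServed g z n
  have hle : ∀ i ∈ Finset.range n, y i - z (predServed f i) ≤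
      M.distance (e (predServed f i)) (e (k + i)) := fun i hi =>
    hyz i (Finset.mem_range.1 hi) _ (predServed_lt f i)
  -- By the telescoping identity the dual value bounds the cost of `C` from below, and that of `g`
  -- from above; optimality closes the chain, so each termwise inequality is an equality.
  have hsum : ∑ i ∈ Finset.range n, (y i - z (predServed f i)) =
      ∑ i ∈ Finset.range n, M.distance (e (predServed f i)) (e (k + i)) := by
    refine le_antisymm (Finset.sum_le_sum hle) ?_
    rw [Finset.sum_sub_distrib] at hup ⊢
    linarith
  intro i hi
  exact ((Finset.sum_eq_sum_iff_of_le hle).1 hsum i (Finset.mem_range.2 hi)).symm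

/-! ### Online algorithms that read the same advice -/

namespace OnlineAlgorithm

variable {V : Type} {k : ℕ} (A : OnlineAlgorithm V k)

theorem bitsRead_le_append (φ : ℕ → Bool) (l l' : List V) :
    A.bitsRead φ l ≤ A.bitsRead φ (l ++ l') := by
  induction l' using List.reverseRecOn with
  | nil => simp
  | append_singleton l' r ih =>
    rw [← List.append_assoc]
    exact ih.trans (A.bitsRead_mono φ _ r)

theorem run_eq_of_take_eq (s₀ : Fin k → V) {φ ψ : ℕ → Bool} {σ τ : List V} {b t : ℕ}
    (hφ : A.bitsRead φ σ ≤ b) (hφψ : ∀ i < b, ψ i = φ i) (ht : σ.take t = τ.take t) :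
    A.run s₀ φ σ t = A.run s₀ ψ τ t := by
  unfold run
  split_ifs with h
  · rfl
  · rw [← ht]
    refine ((A.depends_on_read φ ψ _ fun i hi => hφψ i (hi.trans_le (le_trans ?_ hφ))).1).symm
    conv_rhs => rw [← List.take_append_drop t σ]
    exact A.bitsRead_le_append φ _ _

end OnlineAlgorithm

/-! ### The phase graph

The requests come in phases. A request `(l, A, i)` of layer `l` has a cheap edge to a hub that
encodes its label `i`, and expensive edges (the doors) to the hubs that encode the labels in `A`
of the requests of the previous phase. Along a phase, the door sets shrink. Labels `i ≥ m` belong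
to parked servers. -/

/-- The requests `(l, A, i)` with layer `l`, doors `A` and label `i`. -/
abbrev Site (m k r : ℕ) : Type := Fin (r + 1) × Finset (Fin m) × Fin k

/-- The hub that encodes the label of a site. -/
def labelHub {m k r : ℕ} (x : Site m k r) : ℕ :=
  if (x.2.2 : ℕ) < m then 2 * (x.2.2 : ℕ) + (x.1 : ℕ) % 2 else 0

/-- The hubs adjacent to a site. -/
def SiteAdj {m k r : ℕ} (x : Site m k r) (u : ℕ) : Prop :=
  u = labelHub x ∨ ∃ s ∈ x.2.1, u = 2 * (s : ℕ) + ((x.1 : ℕ) + 1) % 2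

/-- The weight of the edges between hubs, and of the edges to parked servers. -/
noncomputable def bigWeight (r : ℕ) : ℝ := 100 * r * (r + 1)

/-- The weight of the doors of the sites of layer `l`. -/
noncomputable def doorWeight (r l : ℕ) : ℝ := 42 * r - 2 * l

/-- The weight of the edge between a site and a hub. -/
noncomputable def siteWeight {m k r : ℕ} (x : Site m k r) (u : ℕ) : ℝ :=
  if u = labelHub x then (if (x.2.2 : ℕ) < m then 4 * r else bigWeight r) else doorWeight r x.1

/-- A lower bound for the distance between two hubs. -/
noncomputable def hubDist (r u v : ℕ) : ℝ :=
  if u = v then 0 else if u % 2 = v % 2 then 80 * r else 44 * r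

/-! ### Hub distances and edge weights -/

section

variable {m k r : ℕ}

theorem hubDist_self (u : ℕ) : hubDist r u u = 0 := by simp [hubDist]

theorem hubDist_nonneg (u v : ℕ) : 0 ≤ hubDist r u v := by
  unfold hubDist; split_ifs <;> positivity

theorem hubDist_le (u v : ℕ) : hubDist r u v ≤ 80 * r := by
  have : (0 : ℝ) ≤ r := r.cast_nonneg
  unfold hubDist; split_ifs <;> linarith

theorem hubDist_of_ne {u v : ℕ} (h : u ≠ v) (h' : u % 2 = v % 2) : hubDist r u v = 80 * r := by
  simp [hubDist, h, h']

theorem hubDist_of_mod_ne {u v : ℕ} (h : u % 2 ≠ v % 2) : hubDist r u v = 44 * r := by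
  have : u ≠ v := fun h' => h (by rw [h'])
  simp [hubDist, h, this]

/-- The largest value `80 r` is at most twice the smallest nonzero value `44 r`. -/
theorem hubDist_triangle (u v w : ℕ) : hubDist r u w ≤ hubDist r u v + hubDist r v w := by
  have hr : (0 : ℝ) ≤ r := r.cast_nonneg
  by_cases huv : u = v
  · rw [huv, hubDist_self, zero_add]
  by_cases hvw : v = w
  · rw [hvw, hubDist_self, add_zero]
  by_cases h1 : u % 2 = v % 2
  · rw [hubDist_of_ne huv h1]
    have := hubDist_le (r := r) u w
    have := hubDist_nonneg (r := r) v w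
    linarith
  · rw [hubDist_of_mod_ne h1]
    by_cases h2 : v % 2 = w % 2
    · have := hubDist_le (r := r) u w
      rw [hubDist_of_ne hvw h2]
      linarith
    · have := hubDist_le (r := r) u w
      rw [hubDist_of_mod_ne h2]
      linarith

theorem le_bigWeight (r : ℕ) : 100 * (r : ℝ) ≤ bigWeight r := by
  have hr : (0 : ℝ) ≤ r := r.cast_nonneg
  unfold bigWeight
  nlinarith

theorem doorWeight_ge (l : Fin (r + 1)) : 40 * (r : ℝ) ≤ doorWeight r l := by
  have h : (((l : ℕ) : ℝ)) ≤ r := by exact_mod_cast Nat.lt_succ_iff.1 l.2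
  unfold doorWeight
  linarith

theorem doorWeight_le (l : ℕ) : doorWeight r l ≤ 42 * (r : ℝ) := by
  have h : (0 : ℝ) ≤ l := l.cast_nonneg
  unfold doorWeight
  linarith

theorem siteWeight_label {x : Site m k r} (h : (x.2.2 : ℕ) < m) :
    siteWeight x (labelHub x) = 4 * r := by
  simp [siteWeight, h]

theorem siteWeight_parked {x : Site m k r} (h : ¬ (x.2.2 : ℕ) < m) :
    siteWeight x (labelHub x) = bigWeight r := by
  simp [siteWeight, h]

theorem siteWeight_door {x : Site m k r} {u : ℕ} (h : u ≠ labelHub x) :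
    siteWeight x u = doorWeight r x.1 := by
  simp [siteWeight, h]

theorem siteWeight_ge (x : Site m k r) (u : ℕ) : 4 * (r : ℝ) ≤ siteWeight x u := by
  have hr : (0 : ℝ) ≤ r := r.cast_nonneg
  have := doorWeight_ge x.1
  have := le_bigWeight r
  unfold siteWeight
  split_ifs <;> linarith

theorem labelHub_of_lt {x : Site m k r} (h : (x.2.2 : ℕ) < m) :
    labelHub x = 2 * (x.2.2 : ℕ) + (x.1 : ℕ) % 2 := by simp [labelHub, h]

theorem labelHub_mod {x : Site m k r} (h : (x.2.2 : ℕ) < m) :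
    labelHub x % 2 = (x.1 : ℕ) % 2 := by
  rw [labelHub_of_lt h]; omega

theorem labelHub_le (α : ℕ) (hm : 2 * m ≤ α + 1) (x : Site m k r) : labelHub x ≤ α := by
  unfold labelHub; split_ifs <;> omega

/-- An adjacent hub other than the label hub is a door, of the other parity. -/
theorem SiteAdj.mod_of_ne {x : Site m k r} {u : ℕ} (hu : SiteAdj x u) (h : u ≠ labelHub x) :
    u % 2 = ((x.1 : ℕ) + 1) % 2 := by
  obtain ⟨s, -, hs⟩ := hu.resolve_left h
  omega

/-- The origin of the constants: two doors cost at least `2 * 40 r`, and a label edge with a door,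
which joins hubs of different parity, at least `4 r + 40 r`. Parked label edges exceed every hub
distance. -/
theorem hubDist_le_siteWeight (x : Site m k r) {u v : ℕ} (hu : SiteAdj x u) (hv : SiteAdj x v) :
    hubDist r u v ≤ siteWeight x u + siteWeight x v := by
  have hr : (0 : ℝ) ≤ r := r.cast_nonneg
  have h1 := doorWeight_ge x.1
  have h2 := le_bigWeight r
  have h3 := hubDist_le (r := r) u v
  by_cases huv : u = v
  · subst huv
    rw [hubDist_self]
    have := siteWeight_ge x u
    linarith
  by_cases hul : u = labelHub x
  · have hvl : v ≠ labelHub x := fun h => huv (hul.trans h.symm)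
    have h4 := hv.mod_of_ne hvl
    rw [siteWeight_door hvl]
    by_cases hx : (x.2.2 : ℕ) < m
    · have h5 := labelHub_mod hx
      rw [← hul] at h5
      rw [hubDist_of_mod_ne (by omega), hul, siteWeight_label hx]
      linarith
    · rw [hul, siteWeight_parked hx, ← hul]
      linarith
  · rw [siteWeight_door hul]
    have h4 := hu.mod_of_ne hul
    by_cases hvl : v = labelHub x
    · by_cases hx : (x.2.2 : ℕ) < m
      · have h5 := labelHub_mod hx
        rw [← hvl] at h5
        rw [hubDist_of_mod_ne (by omega), hvl, siteWeight_label hx]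
        linarith
      · rw [hvl, siteWeight_parked hx, ← hvl]
        linarith
    · rw [siteWeight_door hvl]
      linarith

end

open Classical in
/-- The hubs adjacent to a site. -/
noncomputable def siteHubs {m k r : ℕ} (α : ℕ) (x : Site m k r) : Finset (Fin (α + 1)) :=
  Finset.univ.filter fun u => SiteAdj x u

/-! ### The graph and the metric on its sites -/

section

variable {m k r α : ℕ}

theorem mem_siteHubs {x : Site m k r} {u : Fin (α + 1)} : u ∈ siteHubs α x ↔ SiteAdj x u := by
  simp [siteHubs]

theorem siteHubs_nonempty (hm : 2 * m ≤ α + 1) (x : Site m k r) : (siteHubs α x).Nonempty :=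
  ⟨⟨labelHub x, Nat.lt_succ_of_le (labelHub_le α hm x)⟩, mem_siteHubs.2 (Or.inl rfl)⟩

theorem card_siteHubs_le (x : Site m k r) : (siteHubs α x).card ≤ m + 1 := by
  rw [← Finset.card_map Fin.valEmbedding]
  refine (Finset.card_le_card (t := insert (labelHub x)
    (Finset.univ.image fun s : Fin m => 2 * (s : ℕ) + ((x.1 : ℕ) + 1) % 2)) ?_).trans
      ((Finset.card_insert_le _ _).trans (Nat.succ_le_succ (Finset.card_image_le.trans (by simp))))
  intro u hu
  simp only [Finset.mem_map, mem_siteHubs, Fin.valEmbedding_apply] at hu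
  obtain ⟨u, hu | ⟨s, -, hs⟩, rfl⟩ := hu
  · exact Finset.mem_insert.2 (Or.inl hu)
  · exact Finset.mem_insert.2 (Or.inr (Finset.mem_image.2 ⟨s, Finset.mem_univ _, hs.symm⟩))

/-- The weighted graph of the lower bound. -/
noncomputable def phaseGraph (m k r α : ℕ) (hm : 2 * m ≤ α + 1) (hr : 0 < r) :
    WeightedGraph (Fin (α + 1) ⊕ Site m k r) :=
  weightedHubGraph (siteHubs α) (siteHubs_nonempty hm) (fun x u => siteWeight x u) (bigWeight r)
    (fun x u => lt_of_lt_of_le (by positivity) (siteWeight_ge x u))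
    (lt_of_lt_of_le (by positivity) (le_bigWeight r))

theorem phaseGraph_treewidth (hm : 2 * m ≤ α + 1) (hm' : m + 1 ≤ α) (hr : 0 < r) :
    (phaseGraph m k r α hm hr).graph.treewidth = α :=
  hubGraph_treewidth _ α (by simp) fun x => (card_siteHubs_le x).trans hm'

variable (hm : 2 * m ≤ α + 1) (hr : 0 < r)

/-- The distance between two sites. -/
noncomputable def siteDist (x y : Site m k r) : ℝ :=
  (phaseGraph m k r α hm hr).distance (Sum.inr x) (Sum.inr y)

theorem siteDist_le {x y : Site m k r} {u : ℕ} (hu : u ≤ α) (hx : SiteAdj x u)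
    (hy : SiteAdj y u) : siteDist hm hr x y ≤ siteWeight x u + siteWeight y u :=
  distance_weightedHubGraph_le (u := ⟨u, Nat.lt_succ_of_le hu⟩)
    (mem_siteHubs.2 hx) (mem_siteHubs.2 hy)

theorem le_siteDist {x y : Site m k r} (hxy : x ≠ y) {c : ℝ}
    (hc : ∀ u v, SiteAdj x u → SiteAdj y v → c ≤ siteWeight x u + hubDist r u v + siteWeight y v) :
    c ≤ siteDist hm hr x y := by
  refine le_distance_weightedHubGraph (fun u v : Fin (α + 1) => hubDist r u v)
    (fun u => hubDist_self _) (fun u v w => hubDist_triangle _ _ _) (fun u v => ?_)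
    (fun x u hu v hv => hubDist_le_siteWeight x (mem_siteHubs.1 hu) (mem_siteHubs.1 hv)) hxy
    fun u hu v hv => hc u v (mem_siteHubs.1 hu) (mem_siteHubs.1 hv)
  have := hubDist_le (r := r) u v
  have := le_bigWeight r
  have : (0 : ℝ) ≤ r := r.cast_nonneg
  linarith

theorem siteDist_nonneg (x y : Site m k r) : 0 ≤ siteDist hm hr x y :=
  WeightedGraph.distance_nonneg _ _ _

theorem siteDist_self (x : Site m k r) : siteDist hm hr x x = 0 :=
  WeightedGraph.distance_self _ _

theorem siteDist_ge_of_ne {x y : Site m k r} (hxy : x ≠ y) : 8 * (r : ℝ) ≤ siteDist hm hr x y := by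
  refine le_siteDist hm hr hxy fun u v _ _ => ?_
  have := siteWeight_ge x u
  have := siteWeight_ge y v
  have := hubDist_nonneg (r := r) u v
  linarith

theorem siteDist_ge_of_parked_left {x y : Site m k r} (hxy : x ≠ y) (hx : ¬ (x.2.2 : ℕ) < m)
    (hA : x.2.1 = ∅) : bigWeight r ≤ siteDist hm hr x y := by
  refine le_siteDist hm hr hxy fun u v hu _ => ?_
  rcases hu with rfl | ⟨s, hs, -⟩
  · rw [siteWeight_parked hx]
    have := siteWeight_ge y v
    have := hubDist_nonneg (r := r) (labelHub x) v
    have : (0 : ℝ) ≤ r := r.cast_nonneg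
    linarith
  · simp [hA] at hs

theorem siteDist_ge_of_parked_right {x y : Site m k r} (hxy : x ≠ y) (hy : ¬ (y.2.2 : ℕ) < m)
    (hB : y.2.1 = ∅) : bigWeight r ≤ siteDist hm hr x y := by
  refine le_siteDist hm hr hxy fun u v _ hv => ?_
  rcases hv with rfl | ⟨s, hs, -⟩
  · rw [siteWeight_parked hy]
    have := siteWeight_ge x u
    have := hubDist_nonneg (r := r) u (labelHub y)
    have : (0 : ℝ) ≤ r := r.cast_nonneg
    linarith
  · simp [hB] at hs

/-- Two sites of the same layer are far apart. -/
theorem siteDist_ge_of_layer_eq {x y : Site m k r} (hl : x.1 = y.1) (hx : (x.2.2 : ℕ) < m)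
    (hy : (y.2.2 : ℕ) < m) (hxy : (x.2.2 : ℕ) ≠ y.2.2) :
    2 * doorWeight r x.1 ≤ siteDist hm hr x y := by
  have hr0 : (0 : ℝ) ≤ r := r.cast_nonneg
  refine le_siteDist hm hr (fun h => hxy (by rw [h])) fun u v hu hv => ?_
  have h1 := doorWeight_le (r := r) x.1
  have h2 := hubDist_nonneg (r := r) u v
  by_cases hul : u = labelHub x <;> by_cases hvl : v = labelHub y
  · rw [hul, hvl, siteWeight_label hx, siteWeight_label hy, hubDist_of_ne]
    · linarith
    · rw [labelHub_of_lt hx, labelHub_of_lt hy, hl]; omega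
    · rw [labelHub_mod hx, labelHub_mod hy, hl]
  · have h3 := hv.mod_of_ne hvl
    have h4 := labelHub_mod hx
    rw [siteWeight_door hvl, hubDist_of_mod_ne, hul, siteWeight_label hx, hl]
    · rw [hl] at h1; linarith
    · rw [hul, h3, h4, hl]; omega
  · have h3 := hu.mod_of_ne hul
    have h4 := labelHub_mod hy
    rw [siteWeight_door hul, hubDist_of_mod_ne, hvl, siteWeight_label hy]
    · linarith
    · rw [hvl, h3, h4, hl]; omega
  · rw [siteWeight_door hul, siteWeight_door hvl, ← hl]
    linarith

/-- Two sites without doors in the same layer are far apart. -/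
theorem siteDist_ge_of_home {x y : Site m k r} (hl : x.1 = y.1) (hx : (x.2.2 : ℕ) < m)
    (hy : (y.2.2 : ℕ) < m) (hxy : (x.2.2 : ℕ) ≠ y.2.2) (hA : x.2.1 = ∅) (hB : y.2.1 = ∅) :
    88 * (r : ℝ) ≤ siteDist hm hr x y := by
  refine le_siteDist hm hr (fun h => hxy (by rw [h])) fun u v hu hv => ?_
  have hul : u = labelHub x := hu.resolve_right (by simp [hA])
  have hvl : v = labelHub y := hv.resolve_right (by simp [hB])
  rw [hul, hvl, siteWeight_label hx, siteWeight_label hy, hubDist_of_ne]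
  · linarith
  · rw [labelHub_of_lt hx, labelHub_of_lt hy, hl]; omega
  · rw [labelHub_mod hx, labelHub_mod hy, hl]

/-- Moving to the next layer is more expensive unless the label of the source is a door of the
target. -/
theorem siteDist_ge_of_layer_succ {x y : Site m k r} (hl : (y.1 : ℕ) = x.1 + 1)
    (hx : (x.2.2 : ℕ) < m) (hy : (y.2.2 : ℕ) < m) {c : ℝ} (hc1 : c ≤ 1)
    (hc : c ≤ 0 ∨ ∀ s ∈ y.2.1, (s : ℕ) ≠ x.2.2) :
    4 * r + doorWeight r y.1 + c ≤ siteDist hm hr x y := by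
  have hr0 : (1 : ℝ) ≤ r := by exact_mod_cast hr
  refine le_siteDist hm hr (fun h => by rw [h] at hl; omega) fun u v hu hv => ?_
  have h1 := doorWeight_le (r := r) y.1
  have h1' : doorWeight r y.1 ≤ 42 * r - 2 := by
    have : (1 : ℝ) ≤ ((y.1 : ℕ) : ℝ) := by exact_mod_cast (by omega : 1 ≤ (y.1 : ℕ))
    unfold doorWeight
    linarith
  have h1'' : doorWeight r x.1 = doorWeight r y.1 + 2 := by
    unfold doorWeight
    rw [hl]
    push_cast
    ring
  have h2 := hubDist_nonneg (r := r) u v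
  by_cases hul : u = labelHub x <;> by_cases hvl : v = labelHub y
  · rw [hul, hvl, siteWeight_label hx, siteWeight_label hy, hubDist_of_mod_ne]
    · linarith
    · rw [labelHub_mod hx, labelHub_mod hy, hl]; omega
  · obtain ⟨s, hs, hvs⟩ := hv.resolve_left hvl
    rcases hc with hc | hxy
    · rw [siteWeight_door hvl, hul, siteWeight_label hx, ← hul]
      linarith
    have h5 := hxy s hs
    rw [siteWeight_door hvl, hubDist_of_ne, hul, siteWeight_label hx]
    · linarith
    · rw [hul, labelHub_of_lt hx]; omega
    · rw [hul, labelHub_of_lt hx]; omega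
  -- Here the move leaves through a door of the source. The decrease of door weights makes this
  -- dearer by 2.
  · rw [siteWeight_door hul, hvl, siteWeight_label hy, ← hvl, h1'']
    linarith
  · have h3 := hu.mod_of_ne hul
    have h4 := hv.mod_of_ne hvl
    rw [siteWeight_door hul, siteWeight_door hvl, hubDist_of_mod_ne (by omega), h1'']
    have := doorWeight_ge y.1
    linarith

theorem siteDist_le_of_door {x y : Site m k r} (hl : (y.1 : ℕ) = x.1 + 1)
    (hx : (x.2.2 : ℕ) < m) (hy : (y.2.2 : ℕ) < m) (hxy : ∃ s ∈ y.2.1, (s : ℕ) = x.2.2) :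
    siteDist hm hr x y ≤ 4 * r + doorWeight r y.1 := by
  obtain ⟨s, hs, hsx⟩ := hxy
  have h := siteDist_le hm hr (labelHub_le α hm x) (Or.inl rfl)
    (show SiteAdj y (labelHub x) from Or.inr ⟨s, hs, by rw [labelHub_of_lt hx]; omega⟩)
  rwa [siteWeight_label hx, siteWeight_door] at h
  have := labelHub_mod hx
  have := labelHub_mod hy
  omega

theorem siteDist_le_of_label {x y : Site m k r} (hl : (x.1 : ℕ) % 2 = (y.1 : ℕ) % 2)
    (hx : (x.2.2 : ℕ) < m) (hxy : (x.2.2 : ℕ) = y.2.2) : siteDist hm hr x y ≤ 8 * r := by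
  have hxy' : labelHub x = labelHub y := by
    rw [labelHub_of_lt hx, labelHub_of_lt (hxy ▸ hx), hl, hxy]
  have h := siteDist_le hm hr (labelHub_le α hm x) (Or.inl rfl) (Or.inl hxy')
  rw [siteWeight_label hx, hxy', siteWeight_label (hxy ▸ hx)] at h
  linarith

end

/-! ### The dual solution -/

/-- The site requested at offset `o` of phase `φ`. The phases divisible by `r + 1` are the home
phases; in the other ones, the doors are closed in the order given by the permutation `ρ φ`. -/
def phaseSite {m k r : ℕ} [NeZero k] (ρ : ℕ → Equiv.Perm (Fin m)) (φ o : ℕ) : Site m k r :=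
  (Fin.ofNat (r + 1) φ, if φ % (r + 1) = 0 then ∅ else
    Finset.univ.filter fun s : Fin m => o ≤ (ρ φ).symm s, Fin.ofNat k o)

/-- The distance by which a server moves in phase `φ`. -/
noncomputable def phaseStep (r φ : ℕ) : ℝ :=
  if φ % (r + 1) = 0 then 8 * r else 4 * r + doorWeight r (φ % (r + 1))

/-- The decrease of the dual variables in phase `φ`. -/
noncomputable def phaseDrop (r φ : ℕ) : ℝ :=
  if φ % (r + 1) = 0 then 40 * r else doorWeight r (φ % (r + 1)) - 4 * r - 1

/-- The total decrease of the dual variables after phase `φ`, up to phase `Φ`. -/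
noncomputable def phasePotential (r Φ φ : ℕ) : ℝ := ∑ i ∈ Finset.Ioc φ Φ, phaseDrop r i

/-- The dual variable of a request as a target. -/
noncomputable def targetValue (m r Φ φ o : ℕ) : ℝ :=
  if o < m then phaseStep r φ + phasePotential r Φ (φ - 1) else phasePotential r Φ φ

/-- The dual variable of a request as a source. -/
noncomputable def sourceValue (m r Φ φ o : ℕ) : ℝ :=
  if o < m then phasePotential r Φ φ else phasePotential r Φ (φ + (r + 1))

section

variable {m k r : ℕ}

theorem doorWeight_mod_ge (φ : ℕ) : 40 * (r : ℝ) ≤ doorWeight r (φ % (r + 1)) :=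
  doorWeight_ge ⟨φ % (r + 1), Nat.mod_lt _ (Nat.succ_pos r)⟩

theorem doorWeight_mod_le {φ : ℕ} (h : φ % (r + 1) ≠ 0) :
    doorWeight r (φ % (r + 1)) ≤ 42 * r - 2 := by
  have : (1 : ℝ) ≤ ((φ % (r + 1) : ℕ) : ℝ) := by exact_mod_cast Nat.one_le_iff_ne_zero.2 h
  unfold doorWeight
  linarith

theorem phaseDrop_ge (hr : 0 < r) (φ : ℕ) : 36 * (r : ℝ) - 1 ≤ phaseDrop r φ := by
  have hr : (1 : ℝ) ≤ r := by exact_mod_cast hr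
  have := doorWeight_mod_ge (r := r) φ
  unfold phaseDrop
  split_ifs <;> linarith

theorem phaseDrop_pos (hr : 0 < r) (φ : ℕ) : 0 < phaseDrop r φ := by
  have hr' : (1 : ℝ) ≤ r := by exact_mod_cast hr
  have := phaseDrop_ge hr φ
  linarith

theorem phaseDrop_le (φ : ℕ) : phaseDrop r φ ≤ 40 * r := by
  have hr : (0 : ℝ) ≤ r := r.cast_nonneg
  unfold phaseDrop
  split_ifs with h
  · exact le_rfl
  · have := doorWeight_mod_le h
    linarith

theorem phaseStep_le (φ : ℕ) : phaseStep r φ ≤ 46 * r := by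
  have hr : (0 : ℝ) ≤ r := r.cast_nonneg
  unfold phaseStep
  split_ifs with h
  · linarith
  · have := doorWeight_mod_le h
    linarith

theorem phasePotential_succ {Φ φ : ℕ} (h : φ < Φ) :
    phasePotential r Φ φ = phaseDrop r (φ + 1) + phasePotential r Φ (φ + 1) := by
  unfold phasePotential
  rw [← Finset.insert_Ioc_add_one_left_eq_Ioc h, Finset.sum_insert (by simp)]

theorem phasePotential_of_le {Φ φ : ℕ} (h : Φ ≤ φ) : phasePotential r Φ φ = 0 := by
  rw [phasePotential, Finset.Ioc_eq_empty (by omega), Finset.sum_empty]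

theorem phasePotential_nonneg (hr : 0 < r) (Φ φ : ℕ) : 0 ≤ phasePotential r Φ φ :=
  Finset.sum_nonneg fun _ _ => (phaseDrop_pos hr _).le

theorem phasePotential_antitone (hr : 0 < r) (Φ : ℕ) : Antitone (phasePotential r Φ) := by
  refine antitone_nat_of_succ_le fun φ => ?_
  rcases lt_or_ge φ Φ with h | h
  · rw [phasePotential_succ h]
    linarith [phaseDrop_pos hr (φ + 1)]
  · rw [phasePotential_of_le h, phasePotential_of_le (by omega)]

/-- Taken over about one cycle of `r + 1` phases, this bounds what moving a parked server could
save; `bigWeight` is chosen to exceed it. -/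
theorem phasePotential_le_add (Φ φ d : ℕ) :
    phasePotential r Φ φ ≤ phasePotential r Φ (φ + d) + d * (40 * r) := by
  induction d with
  | zero => simp
  | succ d ih =>
    refine ih.trans ?_
    push_cast
    rcases lt_or_ge (φ + d) Φ with h | h
    · rw [phasePotential_succ h]
      have := phaseDrop_le (r := r) (φ + d + 1)
      rw [← add_assoc]
      linarith
    · have : (0 : ℝ) ≤ r := r.cast_nonneg
      rw [phasePotential_of_le h, phasePotential_of_le (by omega)]
      linarith

theorem sourceValue_nonneg (hr : 0 < r) (Φ φ o : ℕ) : 0 ≤ sourceValue m r Φ φ o := by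
  unfold sourceValue
  split_ifs <;> exact phasePotential_nonneg hr _ _

theorem mod_succ_of_mod_ne {φ : ℕ} (h : (φ + 1) % (r + 1) ≠ 0) :
    (φ + 1) % (r + 1) = φ % (r + 1) + 1 := by
  have h1 : φ % (r + 1) < r + 1 := Nat.mod_lt _ (Nat.succ_pos r)
  rw [Nat.add_mod] at h ⊢
  rcases Nat.eq_zero_or_pos r with rfl | hr
  · simp [Nat.mod_one] at h
  rw [Nat.mod_eq_of_lt (show 1 < r + 1 by omega)] at h ⊢
  rcases Nat.lt_or_ge (φ % (r + 1) + 1) (r + 1) with h2 | h2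
  · exact Nat.mod_eq_of_lt h2
  · rw [show φ % (r + 1) + 1 = r + 1 by omega, Nat.mod_self] at h
    exact absurd rfl h

theorem mod_of_mod_succ_eq_zero {φ : ℕ} (h : (φ + 1) % (r + 1) = 0) : φ % (r + 1) = r := by
  obtain ⟨c, hc⟩ := Nat.dvd_of_mod_eq_zero h
  obtain ⟨c, rfl⟩ : ∃ d, c = d + 1 := ⟨c - 1, by cases c <;> simp_all⟩
  rw [show φ = r + (r + 1) * c by rw [Nat.mul_succ] at hc; omega, Nat.add_mul_mod_self_left]
  exact Nat.mod_eq_of_lt (Nat.lt_succ_self r)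

theorem add_two_mod_ne (hr : 2 ≤ r) (φ : ℕ) : (φ + 2) % (r + 1) ≠ φ % (r + 1) := by
  intro h
  have h' : (r + 1) ∣ (φ + 2 - φ) := (Nat.modEq_iff_dvd' (by omega)).1 h.symm
  rw [show φ + 2 - φ = 2 by omega] at h'
  have := Nat.le_of_dvd (by omega) h'
  omega

end

/-! ### Feasibility and strictness of the dual solution -/

section

variable {m k r α : ℕ} [NeZero k] (hm : 2 * m ≤ α + 1) (hr : 0 < r)
  (ρ : ℕ → Equiv.Perm (Fin m))

@[simp] theorem phaseSite_layer (φ o : ℕ) :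
    ((phaseSite ρ φ o : Site m k r).1 : ℕ) = φ % (r + 1) := rfl

theorem phaseSite_label (φ : ℕ) {o : ℕ} (h : o < k) :
    ((phaseSite ρ φ o : Site m k r).2.2 : ℕ) = o := Nat.mod_eq_of_lt h

theorem phaseSite_doors_home {φ : ℕ} (o : ℕ) (h : φ % (r + 1) = 0) :
    (phaseSite ρ φ o : Site m k r).2.1 = ∅ := if_pos h

theorem mem_phaseSite_doors {φ : ℕ} (o : ℕ) (h : φ % (r + 1) ≠ 0) (s : Fin m) :
    s ∈ (phaseSite ρ φ o : Site m k r).2.1 ↔ o ≤ (ρ φ).symm s := by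
  simp [phaseSite, h]

theorem phaseSite_layer_ne {φ ψ o o' : ℕ} (h : ψ % (r + 1) ≠ φ % (r + 1)) :
    (phaseSite ρ ψ o' : Site m k r) ≠ phaseSite ρ φ o := fun h' => h (by
  have := congrArg (fun x : Site m k r => (x.1 : ℕ)) h'
  simpa using this)

theorem phaseSite_label_ne {φ ψ o o' : ℕ} (ho : o < k) (ho' : o' < k) (h : o' ≠ o) :
    (phaseSite ρ ψ o' : Site m k r) ≠ phaseSite ρ φ o := fun h' => h (by
  have := congrArg (fun x : Site m k r => (x.2.2 : ℕ)) h'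
  simpa [phaseSite_label, ho, ho'] using this)

/-- Dual feasibility for parked targets. -/
theorem targetValue_sub_le_of_parked {Φ φ ψ o o' : ℕ} (hφ : φ % (r + 1) = 0)
    (ho : o < k) (hom : m ≤ o) (ho' : o' < k) (hψ : m ≤ o' → ψ % (r + 1) = 0)
    (hlt : ψ < φ ∨ ψ = φ ∧ o' < o) :
    targetValue m r Φ φ o - sourceValue m r Φ ψ o' ≤
      siteDist hm hr (phaseSite ρ ψ o' : Site m k r) (phaseSite ρ φ o) := by
  have hnn := siteDist_nonneg hm hr (phaseSite ρ ψ o' : Site m k r) (phaseSite ρ φ o)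
  have hanti := phasePotential_antitone hr Φ
  rw [targetValue, if_neg (by omega), sourceValue]
  split_ifs with hm'
  · have := hanti (show ψ ≤ φ by omega)
    linarith
  · rcases hlt with hlt | ⟨rfl, hlt⟩
    -- Both phases are home phases, so they are at least `r + 1` apart.
    · have hdvd : (r + 1) ∣ (φ - ψ) := Nat.dvd_sub (Nat.dvd_of_mod_eq_zero hφ)
        (Nat.dvd_of_mod_eq_zero (hψ (by omega)))
      have := Nat.le_of_dvd (by omega) hdvd
      have := hanti (show ψ + (r + 1) ≤ φ by omega)
      linarith
    · have h1 := siteDist_ge_of_parked_right hm hr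
        (phaseSite_label_ne (r := r) ρ (φ := ψ) (ψ := ψ) ho ho' hlt.ne)
        (by rw [phaseSite_label ρ _ ho]; omega) (phaseSite_doors_home ρ o hφ)
      have h2 := phasePotential_le_add (r := r) Φ ψ (r + 1)
      have h3 : (0 : ℝ) ≤ r := r.cast_nonneg
      unfold bigWeight at h1
      push_cast at h2
      nlinarith

/-- Dual feasibility for parked sources. -/
theorem targetValue_sub_lt_of_parked_source {Φ φ ψ o o' : ℕ} (hφ : 1 ≤ φ)
    (ho : o < k) (hom : o < m) (ho' : o' < k) (hom' : m ≤ o') (hψ : ψ % (r + 1) = 0)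
    (hlt : ψ ≤ φ) :
    targetValue m r Φ φ o - sourceValue m r Φ ψ o' <
      siteDist hm hr (phaseSite ρ ψ o' : Site m k r) (phaseSite ρ φ o) := by
  have hanti := phasePotential_antitone hr Φ
  rw [targetValue, if_pos hom, sourceValue, if_neg (by omega)]
  have h1 := siteDist_ge_of_parked_left hm hr
    (phaseSite_label_ne (r := r) ρ (φ := φ) (ψ := ψ) ho ho' (by omega))
    (by rw [phaseSite_label ρ _ ho']; omega) (phaseSite_doors_home ρ o' hψ)
  have h2 := phasePotential_le_add (r := r) Φ (φ - 1) (r + 2)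
  have h3 := hanti (show ψ + (r + 1) ≤ φ - 1 + (r + 2) by omega)
  have h4 : (1 : ℝ) ≤ r := by exact_mod_cast hr
  have h5 := phaseStep_le (r := r) φ
  unfold bigWeight at h1
  push_cast at h2
  nlinarith

/-- Dual feasibility for home targets. -/
theorem targetValue_sub_le_of_home {Φ φ ψ o o' : ℕ} (hφ1 : 1 ≤ φ) (hφΦ : φ ≤ Φ)
    (hφ : φ % (r + 1) = 0) (ho : o < k) (hom : o < m) (ho' : o' < k) (hom' : o' < m)
    (hlt : ψ < φ ∨ ψ = φ ∧ o' < o) :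
    targetValue m r Φ φ o - sourceValue m r Φ ψ o' ≤
      siteDist hm hr (phaseSite ρ ψ o' : Site m k r) (phaseSite ρ φ o) := by
  have hnn := siteDist_nonneg hm hr (phaseSite ρ ψ o' : Site m k r) (phaseSite ρ φ o)
  have hanti := phasePotential_antitone hr Φ
  have hr1 : (1 : ℝ) ≤ r := by exact_mod_cast hr
  obtain ⟨φ, rfl⟩ : ∃ χ, φ = χ + 1 := ⟨φ - 1, by omega⟩
  rw [targetValue, if_pos hom, sourceValue, if_pos hom', phaseStep, if_pos hφ,
    Nat.add_sub_cancel]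
  rcases lt_or_ge ψ φ with h | h
  · have h1 : phasePotential r Φ φ ≤ phasePotential r Φ (ψ + 1) := hanti h
    have h2 := phasePotential_succ (r := r) (show ψ < Φ by omega)
    have h3 := phaseDrop_ge hr (ψ + 1)
    linarith
  · rcases hlt with hlt | ⟨rfl, hlt⟩
    · obtain rfl : ψ = φ := by omega
      have h1 := siteDist_ge_of_ne hm hr (phaseSite_layer_ne (k := k) ρ (φ := ψ + 1) (ψ := ψ)
        (o := o) (o' := o') (by rw [hφ, mod_of_mod_succ_eq_zero hφ]; omega))
      linarith
    · have h1 := siteDist_ge_of_home hm hr (x := phaseSite ρ (φ + 1) o')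
        (y := phaseSite (k := k) ρ (φ + 1) o) rfl
        (by rwa [phaseSite_label ρ _ ho']) (by rwa [phaseSite_label ρ _ ho])
        (by rw [phaseSite_label ρ _ ho', phaseSite_label ρ _ ho]; omega)
        (phaseSite_doors_home ρ o' hφ) (phaseSite_doors_home ρ o hφ)
      have h2 := phasePotential_succ (r := r) (show φ < Φ by omega)
      have h3 := phaseDrop_le (r := r) (φ + 1)
      linarith

/-- Dual feasibility for the other targets, strict unless the label of the source is a door of
the target. -/
theorem targetValue_sub_lt {Φ φ ψ o o' : ℕ} (hr2 : 2 ≤ r) (hφ1 : 1 ≤ φ) (hφΦ : φ ≤ Φ)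
    (hφ : φ % (r + 1) ≠ 0) (ho : o < k) (hom : o < m) (ho' : o' < k) (hom' : o' < m)
    (hlt : ψ < φ ∨ ψ = φ ∧ o' < o)
    (hno : ¬ (ψ + 1 = φ ∧ ∃ s : Fin m, (s : ℕ) = o' ∧ o ≤ (ρ φ).symm s)) :
    targetValue m r Φ φ o - sourceValue m r Φ ψ o' <
      siteDist hm hr (phaseSite ρ ψ o' : Site m k r) (phaseSite ρ φ o) := by
  have hnn := siteDist_nonneg hm hr (phaseSite ρ ψ o' : Site m k r) (phaseSite ρ φ o)
  have hanti := phasePotential_antitone hr Φ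
  have hr1 : (2 : ℝ) ≤ r := by exact_mod_cast hr2
  have hD := doorWeight_mod_ge (r := r) φ
  have hD' := doorWeight_mod_le hφ
  have hl1 := phaseSite_label (m := m) (r := r) ρ φ ho
  have hl2 := phaseSite_label (m := m) (r := r) ρ ψ ho'
  rw [targetValue, if_pos hom, sourceValue, if_pos hom', phaseStep, if_neg hφ]
  rcases hlt with hlt | ⟨rfl, hlt⟩
  · rcases (show ψ + 1 = φ ∨ ψ + 2 = φ ∨ ψ + 3 ≤ φ by omega) with rfl | rfl | h3
    · have h1 := siteDist_ge_of_layer_succ hm hr (x := phaseSite ρ ψ o')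
        (y := phaseSite (k := k) ρ (ψ + 1) o) (mod_succ_of_mod_ne hφ) (by rwa [hl2]) (by rwa [hl1])
        le_rfl (Or.inr fun s hs hso => hno ⟨rfl, s, by rw [hso, hl2], (mem_phaseSite_doors ρ o hφ s).1 hs⟩)
      rw [phaseSite_layer] at h1
      rw [Nat.add_sub_cancel]
      linarith
    · have h1 := siteDist_ge_of_ne hm hr (phaseSite_layer_ne (k := k) ρ (φ := ψ + 2) (ψ := ψ)
        (o := o) (o' := o') (add_two_mod_ne hr2 ψ).symm)
      have h2 := phasePotential_succ (r := r) (show ψ < Φ by omega)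
      rw [show ψ + 2 - 1 = ψ + 1 by omega]
      -- Unless the phase between is a home phase, the left side is exactly `8 r - 1`: the doors
      -- lose 2, and the slack 1 in `phaseDrop` gives back 1.
      have h3 : 4 * (r : ℝ) + doorWeight r ((ψ + 2) % (r + 1)) - phaseDrop r (ψ + 1) < 8 * r := by
        unfold phaseDrop
        split_ifs with h
        · linarith
        · have h4 : (ψ + 2) % (r + 1) = (ψ + 1) % (r + 1) + 1 := mod_succ_of_mod_ne hφ
          rw [h4]
          unfold doorWeight
          push_cast
          linarith
      linarith
    -- Two drops exceed one step, so the difference is negative and no distance bound is needed; the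
    -- two sites may even coincide.
    · have h1 := hanti (show ψ + 2 ≤ φ - 1 by omega)
      have h2 := phasePotential_succ (r := r) (show ψ < Φ by omega)
      have h3 := phasePotential_succ (r := r) (show ψ + 1 < Φ by omega)
      have h4 := phaseDrop_ge hr (ψ + 1)
      have h5 := phaseDrop_ge hr (ψ + 1 + 1)
      rw [show ψ + 1 + 1 = ψ + 2 by omega] at h3 h5
      linarith
  -- Within a phase, step plus drop is twice the door weight minus 1; this is where the slack 1
  -- gives strictness.
  · have h1 := siteDist_ge_of_layer_eq hm hr (x := phaseSite ρ ψ o')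
      (y := phaseSite (k := k) ρ ψ o) rfl (by rwa [hl2]) (by rwa [hl1]) (by rw [hl1, hl2]; omega)
    rw [phaseSite_layer] at h1
    have h2 := phasePotential_succ (r := r) (show ψ - 1 < Φ by omega)
    rw [show ψ - 1 + 1 = ψ by omega, phaseDrop, if_neg hφ] at h2
    linarith

/-- Dual feasibility for consecutive phases. -/
theorem targetValue_sub_le_of_succ {Φ φ o o' : ℕ} (hφ : (φ + 1) % (r + 1) ≠ 0) (ho : o < k)
    (hom : o < m) (ho' : o' < k) (hom' : o' < m) :
    targetValue m r Φ (φ + 1) o - sourceValue m r Φ φ o' ≤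
      siteDist hm hr (phaseSite ρ φ o' : Site m k r) (phaseSite ρ (φ + 1) o) := by
  have h1 := siteDist_ge_of_layer_succ hm hr (x := phaseSite ρ φ o')
    (y := phaseSite (k := k) ρ (φ + 1) o) (mod_succ_of_mod_ne hφ)
    (by rwa [phaseSite_label ρ _ ho']) (by rwa [phaseSite_label ρ _ ho]) zero_le_one
    (Or.inl le_rfl)
  rw [phaseSite_layer] at h1
  rw [targetValue, if_pos hom, sourceValue, if_pos hom', phaseStep, if_neg hφ, Nat.add_sub_cancel]
  linarith

end

/-! ### The numbering of the requests -/

/-- The number of requests of a phase. -/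
def phaseSize (m k r φ : ℕ) : ℕ := if φ % (r + 1) = 0 then k else m

/-- The index of the first request of a phase. -/
def phaseStart (m k r φ : ℕ) : ℕ := ∑ i ∈ Finset.range φ, phaseSize m k r i

/-- The phase of a request. -/
def phaseIndex (m k r T : ℕ) : ℕ := Nat.findGreatest (fun φ => phaseStart m k r φ ≤ T) T

/-- The offset of a request in its phase. -/
def phaseOffset (m k r T : ℕ) : ℕ := T - phaseStart m k r (phaseIndex m k r T)

section

variable {m k r : ℕ}

theorem phaseStart_succ (φ : ℕ) :
    phaseStart m k r (φ + 1) = phaseStart m k r φ + phaseSize m k r φ :=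
  Finset.sum_range_succ _ _

theorem phaseStart_zero : phaseStart m k r 0 = 0 := rfl

theorem phaseStart_one : phaseStart m k r 1 = k := by
  simp [phaseStart_succ, phaseStart_zero, phaseSize]

variable (hm0 : 0 < m) (hmk : m ≤ k)

include hmk in
theorem phaseSize_ge (φ : ℕ) : m ≤ phaseSize m k r φ := by
  unfold phaseSize; split_ifs <;> omega

include hmk in
theorem phaseSize_le (φ : ℕ) : phaseSize m k r φ ≤ k := by
  unfold phaseSize; split_ifs <;> omega

include hm0 hmk in
theorem phaseStart_strictMono : StrictMono (phaseStart m k r) := by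
  refine strictMono_nat_of_lt_succ fun φ => ?_
  have := phaseSize_ge (r := r) hmk φ
  rw [phaseStart_succ]
  omega

theorem phaseStart_phaseIndex_le (T : ℕ) : phaseStart m k r (phaseIndex m k r T) ≤ T :=
  Nat.findGreatest_spec (P := fun φ => phaseStart m k r φ ≤ T) (Nat.zero_le T)
    (by simp [phaseStart_zero])

include hm0 hmk in
theorem lt_phaseStart_phaseIndex_succ (T : ℕ) :
    T < phaseStart m k r (phaseIndex m k r T + 1) := by
  by_contra h
  -- Strict monotonicity gives `φ ≤ phaseStart φ`, so the search bound `T` loses nothing.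
  have h1 := (phaseStart_strictMono (r := r) hm0 hmk).le_apply (x := phaseIndex m k r T + 1)
  have h2 := Nat.le_findGreatest (P := fun φ => phaseStart m k r φ ≤ T)
    (h1.trans (not_lt.1 h)) (not_lt.1 h)
  exact absurd h2 (by unfold phaseIndex; omega)

theorem phaseStart_add_phaseOffset (T : ℕ) :
    phaseStart m k r (phaseIndex m k r T) + phaseOffset m k r T = T :=
  Nat.add_sub_cancel' (phaseStart_phaseIndex_le T)

include hm0 hmk in
theorem phaseOffset_lt (T : ℕ) : phaseOffset m k r T < phaseSize m k r (phaseIndex m k r T) := by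
  have h1 := lt_phaseStart_phaseIndex_succ (r := r) hm0 hmk T
  have h2 := phaseStart_add_phaseOffset (m := m) (k := k) (r := r) T
  rw [phaseStart_succ] at h1
  omega

include hm0 hmk in
theorem phaseIndex_add {φ o : ℕ} (ho : o < phaseSize m k r φ) :
    phaseIndex m k r (phaseStart m k r φ + o) = φ := by
  have hmono := phaseStart_strictMono (r := r) hm0 hmk
  have h1 := phaseStart_phaseIndex_le (m := m) (k := k) (r := r) (phaseStart m k r φ + o)
  have h2 := lt_phaseStart_phaseIndex_succ (r := r) hm0 hmk (phaseStart m k r φ + o)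
  have h3 : phaseStart m k r φ + o < phaseStart m k r (φ + 1) := by
    rw [phaseStart_succ]; omega
  have h4 := hmono.lt_iff_lt.1 (h1.trans_lt h3)
  have h5 := hmono.lt_iff_lt.1 ((Nat.le_add_right _ _).trans_lt h2)
  omega

include hm0 hmk in
theorem phaseOffset_add {φ o : ℕ} (ho : o < phaseSize m k r φ) :
    phaseOffset m k r (phaseStart m k r φ + o) = o := by
  rw [phaseOffset, phaseIndex_add hm0 hmk ho]; omega

include hm0 hmk in
theorem phaseIndex_le {Φ T : ℕ} (h : T < phaseStart m k r (Φ + 1)) : phaseIndex m k r T ≤ Φ :=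
  Nat.lt_succ_iff.1 ((phaseStart_strictMono (r := r) hm0 hmk).lt_iff_lt.1
    ((phaseStart_phaseIndex_le T).trans_lt h))

include hm0 hmk in
theorem phaseStart_add_lt {Φ φ o : ℕ} (hφ : φ ≤ Φ) (ho : o < phaseSize m k r φ) :
    phaseStart m k r φ + o < phaseStart m k r (Φ + 1) := by
  have h := (phaseStart_strictMono (r := r) hm0 hmk).monotone (Nat.succ_le_succ hφ)
  rw [Nat.succ_eq_add_one, phaseStart_succ] at h
  exact lt_of_lt_of_le (by omega) h

include hm0 hmk in
theorem one_le_phaseIndex {T : ℕ} (h : k ≤ T) : 1 ≤ phaseIndex m k r T := by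
  by_contra h'
  have h1 := lt_phaseStart_phaseIndex_succ (r := r) hm0 hmk T
  rw [show phaseIndex m k r T = 0 by omega, phaseStart_one] at h1
  omega

include hm0 hmk in
theorem le_phaseStart {φ : ℕ} (h : 1 ≤ φ) : k ≤ phaseStart m k r φ := by
  have h := (phaseStart_strictMono (r := r) hm0 hmk).monotone h
  rwa [phaseStart_one] at h

include hm0 hmk in
/-- The order of the requests is the lexicographic order of phases and offsets. -/
theorem phaseIndex_lt_or {s T : ℕ} (h : s < T) : phaseIndex m k r s < phaseIndex m k r T ∨
    phaseIndex m k r s = phaseIndex m k r T ∧ phaseOffset m k r s < phaseOffset m k r T := by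
  have h1 := phaseStart_add_phaseOffset (m := m) (k := k) (r := r) s
  have h2 := phaseStart_add_phaseOffset (m := m) (k := k) (r := r) T
  rcases lt_trichotomy (phaseIndex m k r s) (phaseIndex m k r T) with h3 | h3 | h3
  · exact Or.inl h3
  · rw [h3] at h1
    exact Or.inr ⟨h3, by omega⟩
  · have h4 := (phaseStart_strictMono (r := r) hm0 hmk).monotone (Nat.succ_le_of_lt h3)
    have h5 := lt_phaseStart_phaseIndex_succ (r := r) hm0 hmk T
    rw [Nat.succ_eq_add_one] at h4
    omega

include hm0 hmk in
theorem mod_eq_zero_of_le_phaseOffset {T : ℕ} (h : m ≤ phaseOffset m k r T) :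
    phaseIndex m k r T % (r + 1) = 0 := by
  by_contra h'
  have := phaseOffset_lt (r := r) hm0 hmk T
  rw [phaseSize, if_neg h'] at this
  omega

end

/-- A permutation of `Fin m` as a function on the natural numbers, the identity from `m` on. -/
def permNat {m : ℕ} (τ : Equiv.Perm (Fin m)) (o : ℕ) : ℕ := if h : o < m then τ ⟨o, h⟩ else o

section

variable {m : ℕ} (τ : Equiv.Perm (Fin m))

theorem permNat_of_lt {o : ℕ} (h : o < m) : permNat τ o = τ ⟨o, h⟩ := dif_pos h

theorem permNat_of_le {o : ℕ} (h : m ≤ o) : permNat τ o = o := dif_neg (by omega)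

theorem permNat_lt_iff {o : ℕ} : permNat τ o < m ↔ o < m := by
  by_cases h : o < m
  · simp [permNat_of_lt τ h, h]
  · simp [permNat_of_le τ (not_lt.1 h), h]

theorem permNat_permNat_symm (o : ℕ) : permNat τ (permNat τ.symm o) = o := by
  by_cases h : o < m
  · rw [permNat_of_lt τ ((permNat_lt_iff τ.symm).2 h)]
    simp [permNat_of_lt τ.symm h]
  · rw [permNat_of_le τ.symm (not_lt.1 h), permNat_of_le τ (not_lt.1 h)]

theorem permNat_injective : Function.Injective (permNat τ) := by
  intro a b h
  have h1 := permNat_permNat_symm τ.symm a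
  have h2 := permNat_permNat_symm τ.symm b
  rw [Equiv.symm_symm] at h1 h2
  rw [← h1, ← h2, h]

theorem permNat_one (o : ℕ) : permNat (1 : Equiv.Perm (Fin m)) o = o := by
  by_cases h : o < m
  · rw [permNat_of_lt _ h]; rfl
  · rw [permNat_of_le _ (not_lt.1 h)]

end

/-! ### The request sequence and its dual solution -/

section

variable (m k r : ℕ)

/-- The site of request `T`: after phase `Φ` the last request is repeated. -/
def requestSite [NeZero k] (ρ : ℕ → Equiv.Perm (Fin m)) (Φ T : ℕ) : Site m k r :=
  phaseSite ρ (phaseIndex m k r (min T (phaseStart m k r (Φ + 1) - 1)))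
    (phaseOffset m k r (min T (phaseStart m k r (Φ + 1) - 1)))

/-- The dual variable of request `T` as a target. -/
noncomputable def requestTarget (Φ T : ℕ) : ℝ :=
  if T < phaseStart m k r (Φ + 1) then
    targetValue m r Φ (phaseIndex m k r T) (phaseOffset m k r T) else 0

/-- The dual variable of request `T` as a source. -/
noncomputable def requestSource (Φ T : ℕ) : ℝ :=
  if T < phaseStart m k r (Φ + 1) then
    sourceValue m r Φ (phaseIndex m k r T) (phaseOffset m k r T) else 0

/-- The permutation by which the servers of the previous phase are assigned to the requests. -/
def phasePerm (ρ : ℕ → Equiv.Perm (Fin m)) (φ : ℕ) : Equiv.Perm (Fin m) :=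
  if φ % (r + 1) = 0 then 1 else ρ φ

/-- The predecessor of request `T` in the optimal schedule. -/
def requestPred (ρ : ℕ → Equiv.Perm (Fin m)) (Φ T : ℕ) : ℕ :=
  if T < phaseStart m k r (Φ + 1) then
    phaseStart m k r (phaseIndex m k r T - if phaseOffset m k r T < m then 1 else r + 1) +
      permNat (phasePerm m r ρ (phaseIndex m k r T)) (phaseOffset m k r T)
  else T - 1

end

/-! ### Primal and dual solutions on the whole request sequence -/

section

variable {m k r α : ℕ} [NeZero k] (ρ : ℕ → Equiv.Perm (Fin m)) (hm0 : 0 < m) (hmk : m ≤ k)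

theorem requestSite_of_lt {Φ T : ℕ} (h : T < phaseStart m k r (Φ + 1)) :
    requestSite m k r ρ Φ T = phaseSite ρ (phaseIndex m k r T) (phaseOffset m k r T) := by
  rw [requestSite, min_eq_left (by omega)]

omit [NeZero k] in
theorem requestSource_nonneg (hr : 0 < r) (Φ T : ℕ) : 0 ≤ requestSource m k r Φ T := by
  unfold requestSource
  split_ifs
  · exact sourceValue_nonneg hr _ _ _
  · exact le_rfl

include hm0 hmk in
theorem requestSite_init (Φ : ℕ) {j : ℕ} (hj : j < k) :
    requestSite m k r ρ Φ j = phaseSite (fun _ => 1) 0 j := by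
  have hj' : j < phaseSize m k r 0 := by simpa [phaseSize] using hj
  have h1 := phaseIndex_add hm0 hmk hj'
  have h2 := phaseOffset_add hm0 hmk hj'
  have h3 := phaseStart_add_lt hm0 hmk (Nat.zero_le Φ) hj'
  rw [phaseStart_zero, zero_add] at h1 h2 h3
  rw [requestSite_of_lt ρ h3, h1, h2]
  simp [phaseSite]

/-- The sites depend on the permutations only through the doors closed so far. -/
theorem phaseSite_congr {ρ ρ' : ℕ → Equiv.Perm (Fin m)} {φ o : ℕ}
    (h : φ % (r + 1) ≠ 0 → ∀ i < o, permNat (ρ φ) i = permNat (ρ' φ) i) :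
    (phaseSite ρ φ o : Site m k r) = phaseSite ρ' φ o := by
  unfold phaseSite
  split_ifs with hφ
  · rfl
  · have key : ∀ {τ τ' : Equiv.Perm (Fin m)}, (∀ i < o, permNat τ i = permNat τ' i) →
        ∀ s, o ≤ (τ.symm s : ℕ) → o ≤ (τ'.symm s : ℕ) := by
      intro τ τ' h s hs
      by_contra hlt
      have h1 := h _ (not_le.1 hlt)
      rw [permNat_of_lt τ (τ'.symm s).2, permNat_of_lt τ' (τ'.symm s).2] at h1
      have h2 : τ (τ'.symm s) = s := by
        apply Fin.ext; simpa using h1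
      rw [← h2, Equiv.symm_apply_apply] at hs
      exact hlt hs
    have : (Finset.univ.filter fun s : Fin m => o ≤ ((ρ φ).symm s : ℕ)) =
        Finset.univ.filter fun s : Fin m => o ≤ ((ρ' φ).symm s : ℕ) := by
      ext s
      simp only [Finset.mem_filter, Finset.mem_univ, true_and]
      exact ⟨key (h hφ) s, key (fun i hi => (h hφ i hi).symm) s⟩
    rw [this]

variable (hm : 2 * m ≤ α + 1) (hr2 : 2 ≤ r) (hr : 0 < r)

include hm0 hmk hr2 in
/-- Dual feasibility. -/
theorem requestTarget_sub_le {Φ s T : ℕ} (hs : s < T) (hT : k ≤ T) :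
    requestTarget m k r Φ T - requestSource m k r Φ s ≤
      siteDist hm hr (requestSite m k r ρ Φ s) (requestSite m k r ρ Φ T) := by
  by_cases hTE : T < phaseStart m k r (Φ + 1)
  · rw [requestTarget, requestSource, if_pos hTE, if_pos (hs.trans hTE),
      requestSite_of_lt ρ hTE, requestSite_of_lt ρ (hs.trans hTE)]
    have h1 := phaseIndex_lt_or (r := r) hm0 hmk hs
    have h2 := (phaseOffset_lt (r := r) hm0 hmk T).trans_le (phaseSize_le hmk _)
    have h3 := (phaseOffset_lt (r := r) hm0 hmk s).trans_le (phaseSize_le hmk _)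
    have h4 := one_le_phaseIndex (r := r) hm0 hmk hT
    have h5 := phaseIndex_le hm0 hmk hTE
    have h6 := mod_eq_zero_of_le_phaseOffset (r := r) (T := T) hm0 hmk
    have h7 := mod_eq_zero_of_le_phaseOffset (r := r) (T := s) hm0 hmk
    by_cases hT' : phaseOffset m k r T < m
    · by_cases hs' : phaseOffset m k r s < m
      · by_cases hφ : phaseIndex m k r T % (r + 1) = 0
        · exact targetValue_sub_le_of_home hm hr ρ h4 h5 hφ h2 hT' h3 hs' h1
        · by_cases hno : phaseIndex m k r s + 1 = phaseIndex m k r T ∧ ∃ i : Fin m,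
              (i : ℕ) = phaseOffset m k r s ∧
                phaseOffset m k r T ≤ (ρ (phaseIndex m k r T)).symm i
          · rw [← hno.1] at hφ ⊢
            exact targetValue_sub_le_of_succ hm hr ρ hφ h2 hT' h3 hs'
          · exact (targetValue_sub_lt hm hr ρ hr2 h4 h5 hφ h2 hT' h3 hs' h1 hno).le
      · exact (targetValue_sub_lt_of_parked_source hm hr ρ h4 h2 hT' h3 (not_lt.1 hs')
          (h7 (not_lt.1 hs')) (by omega)).le
    · exact targetValue_sub_le_of_parked hm hr ρ (h6 (not_lt.1 hT')) h2 (not_lt.1 hT') h3 h7 h1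
  · rw [requestTarget, if_neg hTE]
    have := requestSource_nonneg (m := m) (k := k) hr Φ s
    have := siteDist_nonneg hm hr (requestSite m k r ρ Φ s) (requestSite m k r ρ Φ T)
    linarith

omit [NeZero k] in
include hm0 hmk in
/-- The phase and the offset of the predecessor of a request. -/
theorem requestPred_coords {Φ T : ℕ} (hT : k ≤ T) (hTE : T < phaseStart m k r (Φ + 1)) :
    let d := if phaseOffset m k r T < m then 1 else r + 1
    d ≤ phaseIndex m k r T ∧
      phaseIndex m k r (requestPred m k r ρ Φ T) = phaseIndex m k r T - d ∧
      phaseOffset m k r (requestPred m k r ρ Φ T) =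
        permNat (phasePerm m r ρ (phaseIndex m k r T)) (phaseOffset m k r T) := by
  intro d
  have h1 := one_le_phaseIndex (r := r) hm0 hmk hT
  have h2 := phaseOffset_lt (r := r) hm0 hmk T
  rw [requestPred, if_pos hTE]
  by_cases ho : phaseOffset m k r T < m
  · have hd : d = 1 := if_pos ho
    have hlt : permNat (phasePerm m r ρ (phaseIndex m k r T)) (phaseOffset m k r T) <
        phaseSize m k r (phaseIndex m k r T - d) :=
      ((permNat_lt_iff _).2 ho).trans_le (phaseSize_ge hmk _)
    exact ⟨by omega, phaseIndex_add hm0 hmk hlt, phaseOffset_add hm0 hmk hlt⟩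
  · have hd : d = r + 1 := if_neg ho
    have h3 := mod_eq_zero_of_le_phaseOffset (r := r) hm0 hmk (not_lt.1 ho)
    have h4 : r + 1 ≤ phaseIndex m k r T := Nat.le_of_dvd h1 (Nat.dvd_of_mod_eq_zero h3)
    have hlt : permNat (phasePerm m r ρ (phaseIndex m k r T)) (phaseOffset m k r T) <
        phaseSize m k r (phaseIndex m k r T - d) := by
      rw [permNat_of_le _ (not_lt.1 ho), phaseSize, if_pos]
      · exact h2.trans_le (phaseSize_le hmk _)
      · rw [hd]
        exact Nat.mod_eq_zero_of_dvd (Nat.dvd_sub (Nat.dvd_of_mod_eq_zero h3) dvd_rfl)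
    exact ⟨by omega, phaseIndex_add hm0 hmk hlt, phaseOffset_add hm0 hmk hlt⟩

omit [NeZero k] in
include hm0 hmk in
theorem requestPred_lt {Φ T : ℕ} (hT : k ≤ T) : requestPred m k r ρ Φ T < T := by
  by_cases hTE : T < phaseStart m k r (Φ + 1)
  · obtain ⟨h1, h2, -⟩ := requestPred_coords ρ hm0 hmk hT hTE
    by_contra h
    have h3 : phaseIndex m k r T ≤ phaseIndex m k r (requestPred m k r ρ Φ T) := by
      rcases (not_lt.1 h).lt_or_eq with h | h
      · rcases phaseIndex_lt_or (r := r) hm0 hmk h with h | h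
        · exact h.le
        · exact h.1.le
      · rw [← h]
    rw [h2] at h3
    split_ifs at h1 h3 <;> omega
  · rw [requestPred, if_neg hTE]
    omega

include hm0 hmk in
theorem requestPred_injOn {Φ T T' : ℕ} (hT : k ≤ T) (hT' : k ≤ T')
    (h : requestPred m k r ρ Φ T = requestPred m k r ρ Φ T') : T = T' := by
  by_cases hTE : T < phaseStart m k r (Φ + 1) <;>
    by_cases hTE' : T' < phaseStart m k r (Φ + 1)
  · obtain ⟨h1, h2, h3⟩ := requestPred_coords ρ hm0 hmk hT hTE
    obtain ⟨h1', h2', h3'⟩ := requestPred_coords ρ hm0 hmk hT' hTE'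
    rw [← h] at h2' h3'
    have h4 : phaseOffset m k r T < m ↔ phaseOffset m k r T' < m := by
      rw [← permNat_lt_iff (phasePerm m r ρ (phaseIndex m k r T)), ← h3, h3', permNat_lt_iff]
    have h5 : phaseIndex m k r T = phaseIndex m k r T' := by
      rw [h2'] at h2
      by_cases h6 : phaseOffset m k r T < m
      · rw [if_pos h6] at h1 h2
        rw [if_pos (h4.1 h6)] at h1' h2
        omega
      · rw [if_neg h6] at h1 h2
        rw [if_neg (fun h => h6 (h4.2 h))] at h1' h2
        omega
    have h6 : phaseOffset m k r T = phaseOffset m k r T' := by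
      rw [h3', ← h5] at h3
      exact (permNat_injective _ h3).symm
    rw [← phaseStart_add_phaseOffset (m := m) (k := k) (r := r) T, h5, h6,
      phaseStart_add_phaseOffset]
  · have h1 := requestPred_lt (r := r) ρ hm0 hmk (Φ := Φ) hT
    rw [h, requestPred, if_neg hTE'] at h1
    omega
  · have h1 := requestPred_lt (r := r) ρ hm0 hmk (Φ := Φ) hT'
    rw [← h, requestPred, if_neg hTE] at h1
    omega
  · rw [requestPred, requestPred, if_neg hTE, if_neg hTE'] at h
    have := NeZero.pos k
    omega

include hm0 hmk in
/-- The predecessors attain the value of the dual solution. -/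
theorem siteDist_requestPred_le {Φ T : ℕ} (hre : Even r) (hT : k ≤ T) :
    siteDist hm hr (requestSite m k r ρ Φ (requestPred m k r ρ Φ T)) (requestSite m k r ρ Φ T) ≤
      requestTarget m k r Φ T - requestSource m k r Φ (requestPred m k r ρ Φ T) := by
  by_cases hTE : T < phaseStart m k r (Φ + 1)
  · obtain ⟨h1, h2, h3⟩ := requestPred_coords ρ hm0 hmk hT hTE
    have hpE := (requestPred_lt (r := r) ρ hm0 hmk (Φ := Φ) hT).trans hTE
    have h4 := one_le_phaseIndex (r := r) hm0 hmk hT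
    have h5 := (phaseOffset_lt (r := r) hm0 hmk T).trans_le (phaseSize_le hmk _)
    rw [requestTarget, if_pos hTE, requestSource, if_pos hpE, requestSite_of_lt ρ hTE,
      requestSite_of_lt ρ hpE, h2, h3]
    by_cases ho : phaseOffset m k r T < m
    · simp only [if_pos ho]
      have ho' := (permNat_lt_iff (phasePerm m r ρ (phaseIndex m k r T))).2 ho
      rw [targetValue, if_pos ho, sourceValue, if_pos ho', add_sub_cancel_right]
      obtain ⟨φ, hφ⟩ : ∃ φ, phaseIndex m k r T = φ + 1 := ⟨phaseIndex m k r T - 1, by omega⟩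
      rw [hφ] at ho' ⊢
      rw [Nat.add_sub_cancel, phaseStep]
      have hl := phaseSite_label (m := m) (r := r) ρ φ (ho'.trans_le hmk)
      split_ifs with hφ0
      · rw [phasePerm, if_pos hφ0, permNat_one] at hl ⊢
        refine siteDist_le_of_label hm hr ?_ (by rwa [hl]) (by rw [hl, phaseSite_label ρ _ h5])
        rw [phaseSite_layer, phaseSite_layer, hφ0, mod_of_mod_succ_eq_zero hφ0]
        exact Nat.even_iff.1 hre
      · refine siteDist_le_of_door hm hr (mod_succ_of_mod_ne hφ0) (by rwa [hl])
          (by rwa [phaseSite_label ρ _ h5]) ⟨ρ (φ + 1) ⟨_, ho⟩, ?_, ?_⟩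
        · rw [mem_phaseSite_doors ρ _ hφ0, Equiv.symm_apply_apply]
        · rw [hl, permNat_of_lt _ ho, phasePerm, if_neg hφ0]
    · simp only [if_neg ho]
      have h6 := mod_eq_zero_of_le_phaseOffset (r := r) hm0 hmk (not_lt.1 ho)
      rw [if_neg ho] at h1
      rw [permNat_of_le _ (not_lt.1 ho), targetValue, if_neg ho, sourceValue, if_neg ho,
        Nat.sub_add_cancel h1, sub_self]
      have h7 : (phaseIndex m k r T - (r + 1)) % (r + 1) = 0 :=
        Nat.mod_eq_zero_of_dvd (Nat.dvd_sub (Nat.dvd_of_mod_eq_zero h6) dvd_rfl)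
      have h8 : (phaseSite ρ (phaseIndex m k r T - (r + 1)) (phaseOffset m k r T) :
          Site m k r) = phaseSite ρ (phaseIndex m k r T) (phaseOffset m k r T) := by
        refine Prod.ext (Fin.ext ?_) (Prod.ext ?_ rfl)
        · rw [phaseSite_layer, phaseSite_layer, h6, h7]
        · rw [phaseSite_doors_home ρ _ h6, phaseSite_doors_home ρ _ h7]
      rw [h8, siteDist_self]
  · have hk := NeZero.pos k
    have hE := le_phaseStart (r := r) hm0 hmk (show 1 ≤ Φ + 1 by omega)
    have hs : requestSite m k r ρ Φ (T - 1) = requestSite m k r ρ Φ T := by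
      rw [requestSite, requestSite, min_eq_right (by omega), min_eq_right (by omega)]
    rw [requestPred, if_neg hTE, hs, siteDist_self, requestTarget, if_neg hTE, requestSource]
    split_ifs with h
    -- The first repeated request has its predecessor in phase `Φ`, where the potential has run out.
    · obtain rfl | hT1 := (show T = phaseStart m k r (Φ + 1) ∨ phaseStart m k r (Φ + 1) < T by omega)
      · have h1 : 0 < phaseSize m k r Φ := hm0.trans_le (phaseSize_ge hmk Φ)
        have h2 : phaseStart m k r (Φ + 1) - 1 =
            phaseStart m k r Φ + (phaseSize m k r Φ - 1) := by
          rw [phaseStart_succ]; omega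
        have h3 : phaseSize m k r Φ - 1 < phaseSize m k r Φ := by omega
        rw [h2, phaseIndex_add hm0 hmk h3, sourceValue, phasePotential_of_le le_rfl,
          phasePotential_of_le (by omega), ite_self, sub_self]
      · omega
    · simp

omit [NeZero k] in
include hm0 hmk in
/-- All requests with a nonzero dual variable have a successor. -/
theorem exists_requestPred_eq {Φ s : ℕ} (hs : requestSource m k r Φ s ≠ 0) :
    ∃ T, k ≤ T ∧ T < phaseStart m k r (Φ + 1) ∧ requestPred m k r ρ Φ T = s := by
  by_cases hsE : s < phaseStart m k r (Φ + 1)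
  swap
  · rw [requestSource, if_neg hsE] at hs
    exact absurd rfl hs
  rw [requestSource, if_pos hsE, sourceValue] at hs
  have hsize := phaseOffset_lt (r := r) hm0 hmk s
  by_cases ho : phaseOffset m k r s < m
  · rw [if_pos ho] at hs
    have hΦ : phaseIndex m k r s < Φ := by
      by_contra h
      exact hs (phasePotential_of_le (not_lt.1 h))
    set φ := phaseIndex m k r s with hφ
    have ho' := (permNat_lt_iff (phasePerm m r ρ (φ + 1)).symm).2 ho
    have ho'' := ho'.trans_le (phaseSize_ge (r := r) hmk (φ + 1))
    have hlt := phaseStart_add_lt (Φ := Φ) hm0 hmk hΦ ho''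
    refine ⟨_, (le_phaseStart (r := r) hm0 hmk (Nat.succ_pos φ)).trans (Nat.le_add_right _ _),
      hlt, ?_⟩
    rw [requestPred, if_pos hlt, phaseIndex_add hm0 hmk ho'', phaseOffset_add hm0 hmk ho'',
      if_pos ho', permNat_permNat_symm, Nat.add_sub_cancel, hφ,
      phaseStart_add_phaseOffset]
  · rw [if_neg ho] at hs
    have hΦ : phaseIndex m k r s + (r + 1) ≤ Φ := by
      by_contra h
      exact hs (phasePotential_of_le (by omega))
    have h6 := mod_eq_zero_of_le_phaseOffset (r := r) hm0 hmk (not_lt.1 ho)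
    set φ := phaseIndex m k r s with hφ
    have ho'' : phaseOffset m k r s < phaseSize m k r (φ + (r + 1)) := by
      rw [phaseSize, Nat.add_mod_right, if_pos h6]
      exact hsize.trans_le (phaseSize_le hmk _)
    have hlt := phaseStart_add_lt (Φ := Φ) hm0 hmk hΦ ho''
    refine ⟨_, (le_phaseStart (r := r) hm0 hmk (show 1 ≤ φ + (r + 1) by omega)).trans
      (Nat.le_add_right _ _), hlt, ?_⟩
    rw [requestPred, if_pos hlt, phaseIndex_add hm0 hmk ho'', phaseOffset_add hm0 hmk ho'',
      if_neg ho, permNat_of_le _ (not_lt.1 ho), Nat.add_sub_cancel, hφ,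
      phaseStart_add_phaseOffset]

end

/-- An injective `h` permutes the values, so both sides of the inequalities have the same sum. This
is the uniqueness of the matching between servers and requests. -/
theorem eq_id_of_le_of_injective {m : ℕ} (h : Fin m → Fin m) (hinj : Function.Injective h)
    (hle : ∀ o, o ≤ h o) (o : Fin m) : h o = o := by
  have hsum : ∑ o, (h o : ℕ) = ∑ o : Fin m, (o : ℕ) :=
    Equiv.sum_comp (Equiv.ofBijective h (Finite.injective_iff_bijective.1 hinj)) (fun o => (o : ℕ))
  exact Fin.ext ((Finset.sum_eq_sum_iff_of_le fun o _ => Fin.le_def.1 (hle o)).1 hsum.symm o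
    (Finset.mem_univ o)).symm

/-- Tight predecessors follow the permutations. -/
theorem eq_of_tight {m k r α : ℕ} [NeZero k] (ρ : ℕ → Equiv.Perm (Fin m)) (hm0 : 0 < m)
    (hmk : m ≤ k) (hm : 2 * m ≤ α + 1) (hr2 : 2 ≤ r) (hr : 0 < r) {Φ : ℕ} (p : ℕ → ℕ)
    (hlt : ∀ T, k ≤ T → T < phaseStart m k r (Φ + 1) → p T < T)
    (hinj : ∀ T T', k ≤ T → k ≤ T' → p T = p T' → T = T')
    (htight : ∀ T, k ≤ T → T < phaseStart m k r (Φ + 1) →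
      siteDist hm hr (requestSite m k r ρ Φ (p T)) (requestSite m k r ρ Φ T) =
        requestTarget m k r Φ T - requestSource m k r Φ (p T))
    {φ : ℕ} (hφ1 : 1 ≤ φ) (hφΦ : φ ≤ Φ) (hφ : φ % (r + 1) ≠ 0) (o : Fin m) :
    p (phaseStart m k r φ + o) = phaseStart m k r (φ - 1) + ρ φ o := by
  -- Strict dual inequalities leave only predecessors in the previous phase whose door is still
  -- open.
  have key : ∀ o : Fin m, ∃ c : Fin m,
      p (phaseStart m k r φ + o) = phaseStart m k r (φ - 1) + c ∧ o ≤ (ρ φ).symm c := by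
    intro o
    have ho : (o : ℕ) < phaseSize m k r φ := o.2.trans_le (phaseSize_ge hmk φ)
    have hT : k ≤ phaseStart m k r φ + o :=
      (le_phaseStart hm0 hmk hφ1).trans (Nat.le_add_right _ _)
    have hTE := phaseStart_add_lt (Φ := Φ) hm0 hmk hφΦ ho
    have hp := hlt _ hT hTE
    have ht := htight _ hT hTE
    rw [requestTarget, requestSource, if_pos hTE, if_pos (hp.trans hTE),
      requestSite_of_lt ρ hTE, requestSite_of_lt ρ (hp.trans hTE),
      phaseIndex_add hm0 hmk ho, phaseOffset_add hm0 hmk ho] at ht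
    set s := p (phaseStart m k r φ + o)
    have h1 := phaseIndex_lt_or (r := r) hm0 hmk hp
    rw [phaseIndex_add hm0 hmk ho, phaseOffset_add hm0 hmk ho] at h1
    have hok : (o : ℕ) < k := o.2.trans_le hmk
    have h3 := (phaseOffset_lt (r := r) hm0 hmk s).trans_le (phaseSize_le hmk _)
    by_cases hs : phaseOffset m k r s < m
    · by_contra hno
      refine (targetValue_sub_lt hm hr ρ hr2 hφ1 hφΦ hφ hok o.2 h3 hs h1 ?_).ne ht.symm
      rintro ⟨h4, c, hc, hoc⟩
      refine hno ⟨c, ?_, hoc⟩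
      rw [hc, ← h4, Nat.add_sub_cancel, phaseStart_add_phaseOffset]
    · exact absurd ht.symm (targetValue_sub_lt_of_parked_source hm hr ρ hφ1 hok o.2 h3
        (not_lt.1 hs) (mod_eq_zero_of_le_phaseOffset hm0 hmk (not_lt.1 hs)) (by omega)).ne
  choose c hc hoc using key
  have hid := eq_id_of_le_of_injective (fun o => (ρ φ).symm (c o)) (fun a b hab => by
    have h1 : c a = c b := (ρ φ).symm.injective hab
    have h2 := hinj _ _ ((le_phaseStart hm0 hmk hφ1).trans (Nat.le_add_right _ _))
      ((le_phaseStart hm0 hmk hφ1).trans (Nat.le_add_right _ _))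
      ((hc a).trans ((congrArg _ (congrArg _ h1)).trans (hc b).symm))
    exact Fin.ext (by omega)) hoc o
  rw [hc o]
  have : c o = ρ φ o := by
    rw [← hid, Equiv.apply_symm_apply, hid]
  rw [this]

/-! ### Counting the advice strings -/

section

variable {m k r α : ℕ} [NeZero k]

/-- The initial configuration: all servers are at the sites of the home phase. -/
def homeConfig (m k r α : ℕ) [NeZero k] (j : Fin k) : Fin (α + 1) ⊕ Site m k r :=
  Sum.inr (phaseSite (fun _ => 1) 0 j)

theorem homeConfig_injective : Function.Injective (homeConfig m k r α) := by
  intro i j h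
  have := congrArg (fun x : Site m k r => (x.2.2 : ℕ)) (Sum.inr_injective h)
  simp only [phaseSite_label _ _ i.2, phaseSite_label _ _ j.2] at this
  exact Fin.ext this

/-- The first `n` requests. -/
def requestList (m k r α : ℕ) [NeZero k] (ρ : ℕ → Equiv.Perm (Fin m)) (Φ n : ℕ) :
    List (Fin (α + 1) ⊕ Site m k r) :=
  List.ofFn fun t : Fin n => Sum.inr (requestSite m k r ρ Φ (k + t))

theorem length_requestList (ρ : ℕ → Equiv.Perm (Fin m)) (Φ n : ℕ) :
    (requestList m k r α ρ Φ n).length = n := List.length_ofFn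

variable (hm0 : 0 < m) (hmk : m ≤ k) (hm : 2 * m ≤ α + 1) (hr2 : 2 ≤ r) (hre : Even r)
  (hr : 0 < r)

include hm0 hmk hr2 hre in
/-- Every optimal schedule follows the permutations. -/
theorem predServed_of_isOptimalSchedule (ρ : ℕ → Equiv.Perm (Fin m)) {Φ n : ℕ}
    (hn : phaseStart m k r (Φ + 1) ≤ k + n) {C : ℕ → Fin k → Fin (α + 1) ⊕ Site m k r}
    (hC : IsOptimalSchedule (phaseGraph m k r α hm hr) (homeConfig m k r α)
      (requestList m k r α ρ Φ n) C) {f : ℕ → Fin k}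
    (hf : ∀ t < n, C (t + 1) (f t) = Sum.inr (requestSite m k r ρ Φ (k + t)))
    {φ : ℕ} (hφ1 : 1 ≤ φ) (hφΦ : φ ≤ Φ) (hφ : φ % (r + 1) ≠ 0) (o : Fin m) :
    predServed f (phaseStart m k r φ + o - k) = phaseStart m k r (φ - 1) + ρ φ o := by
  have : Nonempty (Fin k) := ⟨⟨0, NeZero.pos k⟩⟩
  have htight := distance_predServed_eq_of_isOptimalSchedule (phaseGraph m k r α hm hr)
    (fun T => Sum.inr (requestSite m k r ρ Φ T)) n
    (fun i => requestTarget m k r Φ (k + i)) (requestSource m k r Φ)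
    (fun i => requestPred m k r ρ Φ (k + i))
    (fun i _ s hs => requestTarget_sub_le ρ hm0 hmk hm hr2 hr hs (Nat.le_add_right _ _))
    (fun i _ => requestPred_lt ρ hm0 hmk (Nat.le_add_right _ _))
    (fun i _ i' _ h => by
      have := requestPred_injOn ρ hm0 hmk (Nat.le_add_right _ _) (Nat.le_add_right _ _) h
      omega)
    (fun i _ => siteDist_requestPred_le ρ hm0 hmk hm hr hre (Nat.le_add_right _ _))
    (fun s _ => requestSource_nonneg hr Φ s)
    (fun s _ h => by
      obtain ⟨T, hT, hTE, hTs⟩ := exists_requestPred_eq ρ hm0 hmk h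
      exact ⟨T - k, by omega, by rw [Nat.add_sub_cancel' hT]; exact hTs⟩)
    (fun j => by rw [requestSite_init ρ hm0 hmk Φ j.2]; rfl) rfl hC hf
  refine eq_of_tight ρ hm0 hmk hm hr2 hr (fun T => predServed f (T - k)) ?_ ?_ ?_ hφ1 hφΦ hφ o
  · intro T hT _
    have := predServed_lt f (T - k)
    omega
  · intro T T' hT hT' h
    have := predServed_injective f h
    omega
  · intro T hT hTE
    have := htight (T - k) (by omega)
    rw [Nat.add_sub_cancel' hT] at this
    exact this

/-- The server that is at `v` in the configuration `c`, if there is one. -/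
noncomputable def serverAt {V : Type} (c : Fin k → V) (v : V) : Fin k :=
  haveI : Nonempty (Fin k) := ⟨⟨0, NeZero.pos k⟩⟩
  Classical.epsilon fun j => c j = v

theorem serverAt_spec {V : Type} {c : Fin k → V} {v : V} (h : ∃ j, c j = v) :
    c (serverAt c v) = v :=
  Classical.epsilon_spec (p := fun j => c j = v) h

theorem take_requestList_congr {ρ ρ' : ℕ → Equiv.Perm (Fin m)} {Φ n t : ℕ}
    (h : ∀ i < t, requestSite m k r ρ Φ (k + i) = requestSite m k r ρ' Φ (k + i)) :
    (requestList m k r α ρ Φ n).take t = (requestList m k r α ρ' Φ n).take t := by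
  refine List.ext_getElem (by simp [length_requestList]) fun i h1 h2 => ?_
  rw [List.length_take, length_requestList] at h1
  simp only [List.getElem_take, requestList, List.getElem_ofFn]
  rw [h i (by omega)]

include hm0 hmk hr2 hre in
/-- The requests can be reconstructed from the advice. -/
theorem perm_eq_of_advice_eq (A : OnlineAlgorithm (Fin (α + 1) ⊕ Site m k r) k)
    {ρ ρ' : ℕ → Equiv.Perm (Fin m)} {Φ n b : ℕ} (hn : phaseStart m k r (Φ + 1) ≤ k + n)
    {τ τ' : ℕ → Bool}
    (hτ : IsOptimalSchedule (phaseGraph m k r α hm hr) (homeConfig m k r α)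
      (requestList m k r α ρ Φ n) (A.run (homeConfig m k r α) τ (requestList m k r α ρ Φ n)))
    (hτ' : IsOptimalSchedule (phaseGraph m k r α hm hr) (homeConfig m k r α)
      (requestList m k r α ρ' Φ n) (A.run (homeConfig m k r α) τ' (requestList m k r α ρ' Φ n)))
    (hb : A.bitsRead τ (requestList m k r α ρ Φ n) ≤ b) (hττ' : ∀ i < b, τ' i = τ i)
    {φ : ℕ} (hφΦ : φ ≤ Φ) (hφ : φ % (r + 1) ≠ 0) : ρ φ = ρ' φ := by
  set C := A.run (homeConfig m k r α) τ (requestList m k r α ρ Φ n) with hC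
  set C' := A.run (homeConfig m k r α) τ' (requestList m k r α ρ' Φ n) with hC'
  -- The serving server is chosen as a function of configuration and request alone, so equal runs
  -- give equal choices.
  let f : ℕ → Fin k := fun t => serverAt (C (t + 1)) (Sum.inr (requestSite m k r ρ Φ (k + t)))
  let f' : ℕ → Fin k := fun t => serverAt (C' (t + 1)) (Sum.inr (requestSite m k r ρ' Φ (k + t)))
  have hf : ∀ t < n, C (t + 1) (f t) = Sum.inr (requestSite m k r ρ Φ (k + t)) := by
    intro t ht
    refine serverAt_spec ?_
    obtain ⟨j, hj⟩ := hτ.1.2 t (by rwa [length_requestList])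
    exact ⟨j, hj.trans (by simp [requestList])⟩
  have hf' : ∀ t < n, C' (t + 1) (f' t) = Sum.inr (requestSite m k r ρ' Φ (k + t)) := by
    intro t ht
    refine serverAt_spec ?_
    obtain ⟨j, hj⟩ := hτ'.1.2 t (by rwa [length_requestList])
    exact ⟨j, hj.trans (by simp [requestList])⟩
  have hp := fun {φ} => predServed_of_isOptimalSchedule hm0 hmk hm hr2 hre hr ρ hn hτ hf (φ := φ)
  have hp' := fun {φ} =>
    predServed_of_isOptimalSchedule hm0 hmk hm hr2 hre hr ρ' hn hτ' hf' (φ := φ)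
  -- The sites up to `T` involve only earlier values of the permutations. If those agree, the
  -- algorithm behaves identically through request `T`, and the predecessor of `T` reveals the value
  -- at `T`.
  have key : ∀ T, T < phaseStart m k r (Φ + 1) → phaseIndex m k r T % (r + 1) ≠ 0 →
      permNat (ρ (phaseIndex m k r T)) (phaseOffset m k r T) =
        permNat (ρ' (phaseIndex m k r T)) (phaseOffset m k r T) := by
    intro T
    induction T using Nat.strong_induction_on with
    | _ T ih =>
      intro hTE hT0
      have hsite : ∀ T' ≤ T, requestSite m k r ρ Φ T' = requestSite m k r ρ' Φ T' := by
        intro T' hT'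
        rw [requestSite_of_lt ρ (hT'.trans_lt hTE), requestSite_of_lt ρ' (hT'.trans_lt hTE)]
        refine phaseSite_congr fun h0 i hi => ?_
        have hsize := hi.trans (phaseOffset_lt (r := r) hm0 hmk T')
        have hlt : phaseStart m k r (phaseIndex m k r T') + i < T' := by
          have := phaseStart_add_phaseOffset (m := m) (k := k) (r := r) T'
          omega
        have := ih _ (hlt.trans_le hT') ((hlt.trans_le hT').trans hTE)
        rw [phaseIndex_add hm0 hmk hsize, phaseOffset_add hm0 hmk hsize] at this
        exact this h0
      have hoff : phaseOffset m k r T < m := by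
        by_contra h
        exact hT0 (mod_eq_zero_of_le_phaseOffset hm0 hmk (not_lt.1 h))
      have hidx : 1 ≤ phaseIndex m k r T := by
        by_contra h
        exact hT0 (by rw [show phaseIndex m k r T = 0 by omega, Nat.zero_mod])
      have hserv : ∀ i ≤ T - k, f i = f' i := by
        intro i hi
        have hkT := (le_phaseStart (r := r) hm0 hmk hidx).trans (phaseStart_phaseIndex_le T)
        have hrun : C (i + 1) = C' (i + 1) := A.run_eq_of_take_eq _ hb hττ'
          (take_requestList_congr fun i' hi' => hsite _ (by omega))
        simp only [f, f', hrun, hsite (k + i) (by omega)]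
      have h1 := hp hidx (phaseIndex_le hm0 hmk hTE) hT0 ⟨_, hoff⟩
      have h2 := hp' hidx (phaseIndex_le hm0 hmk hTE) hT0 ⟨_, hoff⟩
      simp only [phaseStart_add_phaseOffset] at h1 h2
      rw [predServed_congr _ hserv, h2] at h1
      rw [permNat_of_lt _ hoff, permNat_of_lt _ hoff]
      omega
  ext o
  have ho : (o : ℕ) < phaseSize m k r φ := o.2.trans_le (phaseSize_ge hmk φ)
  have h := key _ (phaseStart_add_lt hm0 hmk hφΦ ho)
  rw [phaseIndex_add hm0 hmk ho, phaseOffset_add hm0 hmk ho] at h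
  have := h hφ
  rwa [permNat_of_lt _ o.2, permNat_of_lt _ o.2] at this

include hm0 hmk hr2 hre in
/-- The advice encodes a permutation for each phase that is not a home phase. -/
theorem factorial_pow_le_two_pow (A : OnlineAlgorithm (Fin (α + 1) ⊕ Site m k r) k)
    {Φ n b : ℕ} (hn : phaseStart m k r (Φ + 1) ≤ k + n)
    (hA : A.IsOptimalWithAdvice (phaseGraph m k r α hm hr) (homeConfig m k r α) n b) :
    m.factorial ^ (Φ - Φ / (r + 1)) ≤ 2 ^ b := by
  classical
  let S : Finset ℕ := (Finset.Ioc 0 Φ).filter fun φ => ¬ (r + 1) ∣ φ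
  let ext : (S → Equiv.Perm (Fin m)) → ℕ → Equiv.Perm (Fin m) :=
    fun g φ => if h : φ ∈ S then g ⟨φ, h⟩ else 1
  choose τ hτ hτb using fun g : S → Equiv.Perm (Fin m) =>
    hA (requestList m k r α (ext g) Φ n) (length_requestList _ _ _)
  -- The first `b` bits encode the whole family of permutations.
  have hinj : Function.Injective fun (g : S → Equiv.Perm (Fin m)) (i : Fin b) => τ g i := by
    intro g g' h
    funext ⟨φ, hφ⟩
    obtain ⟨h1, h2⟩ := Finset.mem_filter.1 hφ
    rw [Finset.mem_Ioc] at h1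
    have := perm_eq_of_advice_eq hm0 hmk hm hr2 hre hr A hn (hτ g) (hτ g') (hτb g)
      (fun i hi => (congrFun h ⟨i, hi⟩).symm) h1.2
      (fun h0 => h2 (Nat.dvd_of_mod_eq_zero h0))
    simpa [ext, hφ] using this
  have hcard := Fintype.card_le_of_injective _ hinj
  have hS : S.card = Φ - Φ / (r + 1) := by
    have h1 := Finset.card_filter_add_card_filter_not (s := Finset.Ioc 0 Φ)
      (fun φ => (r + 1) ∣ φ)
    rw [Nat.Ioc_filter_dvd_card_eq_div, Nat.card_Ioc] at h1
    have : S.card = ((Finset.Ioc 0 Φ).filter fun φ => ¬ (r + 1) ∣ φ).card := rfl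
    omega
  simpa [Fintype.card_perm, hS] using hcard

end

/-! ### Numerical estimates -/

theorem logb_two_le_of_pow_le {x p q : ℕ} (hx : 0 < x) (h : x ^ p ≤ 2 ^ q) :
    p * Real.logb 2 x ≤ q := by
  rw [← Real.logb_pow, Real.logb_le_iff_le_rpow one_lt_two (by positivity), Real.rpow_natCast]
  exact_mod_cast h

theorem le_logb_two_of_le_pow {x p q : ℕ} (hx : 0 < x) (h : 2 ^ q ≤ x ^ p) :
    q ≤ p * Real.logb 2 x := by
  rw [← Real.logb_pow, Real.le_logb_iff_rpow_le one_lt_two (by positivity), Real.rpow_natCast]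
  exact_mod_cast h

/-- The factor 3000 is 4000 times the fraction `3/4` of requests left after discarding `m - 1` of `n
≥ 4 m`, and 0.22 is 1.22 minus the 1 lost in `α ≤ 2 m`. The case `m = 6` holds narrowly. The
inductive step has room: the right side gains `3000 log (m + 1)`, the left at most `2000 (log (m +
1) - 0.22 log 2) + 2001`. -/
theorem log_factorial_ge (m : ℕ) (hm : 6 ≤ m) :
    (2000 * m + 1) * (Real.log m - 0.22 * Real.log 2) ≤ 3000 * Real.log m.factorial := by
  have h2 := Real.log_two_gt_d9
  induction m, hm using Nat.le_induction with
  | base =>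
    have h720 : Real.log (Nat.factorial 6 : ℕ) =
        4 * Real.log 2 + 2 * Real.log 3 + Real.log 5 := by
      rw [show ((Nat.factorial 6 : ℕ) : ℝ) = 2 ^ 4 * 3 ^ 2 * 5 by norm_num [Nat.factorial],
        Real.log_mul (by norm_num) (by norm_num), Real.log_mul (by norm_num) (by norm_num),
        Real.log_pow, Real.log_pow]
      norm_num
    have h6 : Real.log (6 : ℕ) = Real.log 2 + Real.log 3 := by
      rw [← Real.log_mul (by norm_num) (by norm_num)]; norm_num
    have h3 : Real.log 3 ≤ 2 * Real.log 2 := by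
      have : Real.log 3 ≤ Real.log (2 ^ 2) := Real.log_le_log (by norm_num) (by norm_num)
      rw [Real.log_pow] at this
      exact_mod_cast this
    have h5 : 16 * Real.log 3 ≤ 7 * Real.log 2 + 8 * Real.log 5 := by
      have : Real.log (3 ^ 16) ≤ Real.log (2 ^ 7 * 5 ^ 8) :=
        Real.log_le_log (by norm_num) (by norm_num)
      rw [Real.log_mul (by norm_num) (by norm_num), Real.log_pow, Real.log_pow,
        Real.log_pow] at this
      exact_mod_cast this
    rw [h720, h6]
    push_cast
    linarith
  | succ m hm ih =>
    have hm' : (6 : ℝ) ≤ m := by exact_mod_cast hm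
    have hfac : Real.log ((m + 1).factorial : ℕ) = Real.log (m + 1) + Real.log m.factorial := by
      rw [Nat.factorial_succ, Nat.cast_mul, Real.log_mul (by positivity) (by positivity)]
      push_cast
      rfl
    have hlog : Real.log (m + 1) - Real.log m ≤ 1 / m := by
      rw [← Real.log_div (by positivity) (by positivity)]
      refine (Real.log_le_sub_one_of_pos (by positivity)).trans (le_of_eq ?_)
      field_simp
      ring
    have hmul : (2000 * (m : ℝ) + 1) * (Real.log (m + 1) - Real.log m) ≤ 2001 := by
      calc (2000 * (m : ℝ) + 1) * (Real.log (m + 1) - Real.log m)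
          ≤ (2000 * (m : ℝ) + 1) * (1 / m) := by gcongr
        _ ≤ 2001 := by
          rw [mul_one_div, div_le_iff₀ (by positivity)]
          linarith
    have h7 : 5 * Real.log 2 ≤ 2 * Real.log (m + 1) := by
      have : Real.log (2 ^ 5) ≤ Real.log ((m + 1 : ℝ) ^ 2) :=
        Real.log_le_log (by norm_num) (by nlinarith)
      rw [Real.log_pow, Real.log_pow] at this
      exact_mod_cast this
    rw [hfac]
    push_cast
    linarith

/-- For small `α` the logarithms are replaced by rational bounds `q / p ≤ log₂ m!` and `log₂ α ≤ q'
/ p'`, certified by comparing integer powers. -/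
theorem advice_arithmetic_of_pow_le {m α n : ℕ} (p q p' q' : ℕ) (hp : 0 < p) (hp' : 0 < p')
    (hα : 0 < α) (hmn : m ≤ n) (hl : 2 ^ q ≤ m.factorial ^ p) (hu : α ^ p' ≤ 2 ^ q')
    (h : (2000 * (m : ℝ) + 1) * (n * (q' / p' - 1.22)) ≤ 4000 * (((n : ℝ) + 1 - m) * (q / p))) :
    (2000 * (m : ℝ) + 1) * (n * (Real.logb 2 α - 1.22)) ≤
      4000 * (((n : ℝ) + 1 - m) * Real.logb 2 m.factorial) := by
  have hmn' : (m : ℝ) ≤ n := by exact_mod_cast hmn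
  have hL : (q : ℝ) / p ≤ Real.logb 2 m.factorial := by
    rw [div_le_iff₀' (by positivity)]
    exact le_logb_two_of_le_pow m.factorial_pos hl
  have hU : Real.logb 2 α ≤ (q' : ℝ) / p' := by
    rw [le_div_iff₀' (by positivity)]
    exact logb_two_le_of_pow_le hα hu
  have h1 := mul_le_mul_of_nonneg_left hL (by linarith : 0 ≤ (n : ℝ) + 1 - m)
  have h2 := mul_le_mul_of_nonneg_left hU (by positivity : 0 ≤ (2000 * (m : ℝ) + 1) * n)
  linarith

theorem advice_arithmetic {k α m n : ℕ} (hα : 4 ≤ α) (hαk : α < 2 * k) (hm : m = (α + 1) / 2)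
    (hn : 4 * k ≤ n) : (2000 * (m : ℝ) + 1) * (n * (Real.logb 2 α - 1.22)) ≤
      4000 * (((n : ℝ) + 1 - m) * Real.logb 2 m.factorial) := by
  have hmn : (4 : ℝ) * m ≤ n := by exact_mod_cast (by omega : 4 * m ≤ n)
  have hm0 : (0 : ℝ) ≤ m := m.cast_nonneg
  rcases Nat.lt_or_ge m 6 with hm6 | hm6
  · have hα10 : α ≤ 10 := by omega
    -- From `α < 2 k` follows `k ≥ α / 2 + 1`; the case `α = 4` needs this rather than just `n ≥ 4
    -- m`.
    have hn0 : 4 * (α / 2 + 1) ≤ n := by omega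
    interval_cases α <;> norm_num at hm <;> subst hm
    · have hn' : (12 : ℝ) ≤ n := by exact_mod_cast hn0
      exact advice_arithmetic_of_pow_le 1 1 1 2 (by decide) (by decide) (by decide) (by omega)
        (by decide) (by decide) (by push_cast; linarith)
    · have hn' : (12 : ℝ) ≤ n := by exact_mod_cast hn0
      exact advice_arithmetic_of_pow_le 2 5 3 7 (by decide) (by decide) (by decide) (by omega)
        (by decide) (by decide) (by push_cast; linarith)
    · have hn' : (16 : ℝ) ≤ n := by exact_mod_cast hn0
      exact advice_arithmetic_of_pow_le 2 5 5 13 (by decide) (by decide) (by decide) (by omega)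
        (by decide) (by decide) (by push_cast; linarith)
    · have hn' : (16 : ℝ) ≤ n := by exact_mod_cast hn0
      exact advice_arithmetic_of_pow_le 2 9 6 17 (by decide) (by decide) (by decide) (by omega)
        (by decide) (by decide) (by push_cast; linarith)
    · have hn' : (20 : ℝ) ≤ n := by exact_mod_cast hn0
      exact advice_arithmetic_of_pow_le 2 9 1 3 (by decide) (by decide) (by decide) (by omega)
        (by decide) (by decide) (by push_cast; linarith)
    · have hn' : (20 : ℝ) ≤ n := by exact_mod_cast hn0
      exact advice_arithmetic_of_pow_le 4 27 5 16 (by decide) (by decide) (by decide) (by omega)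
        (by decide) (by decide) (by push_cast; linarith)
    · have hn' : (24 : ℝ) ≤ n := by exact_mod_cast hn0
      exact advice_arithmetic_of_pow_le 4 27 3 10 (by decide) (by decide) (by decide) (by omega)
        (by decide) (by decide) (by push_cast; linarith)
  · have h2 : 0 < Real.log 2 := Real.log_pos one_lt_two
    have hfac := log_factorial_ge m hm6
    have hα2 : Real.log α ≤ Real.log 2 + Real.log m := by
      rw [← Real.log_mul (by norm_num) (by positivity)]
      exact Real.log_le_log (by positivity) (by exact_mod_cast (by omega : α ≤ 2 * m))
    have hL0 : 0 ≤ Real.log (m.factorial : ℕ) := Real.log_natCast_nonneg _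
    have h3 : (2000 * (m : ℝ) + 1) * (Real.log α - 1.22 * Real.log 2) ≤
        3000 * Real.log m.factorial :=
      (mul_le_mul_of_nonneg_left (by linarith) (by linarith)).trans hfac
    have h4 : (n : ℝ) * ((2000 * (m : ℝ) + 1) * (Real.log α - 1.22 * Real.log 2)) ≤
        n * (3000 * Real.log m.factorial) := mul_le_mul_of_nonneg_left h3 n.cast_nonneg
    have h5 : 3 * (n : ℝ) * Real.log m.factorial ≤
        4 * ((n : ℝ) + 1 - m) * Real.log m.factorial :=
      mul_le_mul_of_nonneg_right (by linarith) hL0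
    unfold Real.logb
    rw [← sub_nonneg]
    have h6 : 4000 * (((n : ℝ) + 1 - m) * (Real.log m.factorial / Real.log 2)) -
        (2000 * (m : ℝ) + 1) * (n * (Real.log α / Real.log 2 - 1.22)) =
        (4000 * (((n : ℝ) + 1 - m) * Real.log m.factorial) -
          (2000 * (m : ℝ) + 1) * (n * (Real.log α - 1.22 * Real.log 2))) / Real.log 2 := by
      field_simp
    rw [h6]
    exact div_nonneg (by linarith) h2.le

theorem phaseStart_add_mul (m k r Φ : ℕ) :
    phaseStart m k r (Φ + 1) + m * (Φ / (r + 1)) = k + m * Φ + k * (Φ / (r + 1)) := by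
  induction Φ with
  | zero => simp [phaseStart_one]
  | succ Φ ih =>
    rw [phaseStart_succ, Nat.succ_div, phaseSize]
    by_cases h : r + 1 ∣ Φ + 1
    · rw [if_pos (Nat.mod_eq_zero_of_dvd h), if_pos h]
      linarith
    · rw [if_neg (fun h' => h (Nat.dvd_of_mod_eq_zero h')), if_neg h]
      linarith

/-- Most of the `n` requests belong to phases that are not home phases. -/
theorem exists_phase_count {m k n : ℕ} (hm0 : 0 < m) (hmk : m ≤ k) :
    ∃ Φ, phaseStart m k (2000 * k) (Φ + 1) ≤ k + n ∧
      2000 * (n + 1) ≤ (2000 * m + 1) * (Φ - Φ / (2000 * k + 1)) + 2000 * m := by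
  set r := 2000 * k with hr
  have h1 := one_le_phaseIndex (r := r) hm0 hmk (Nat.le_add_right k n)
  obtain ⟨Φ, hΦ⟩ : ∃ Φ, phaseIndex m k r (k + n) = Φ + 1 := ⟨_, (Nat.sub_add_cancel h1).symm⟩
  have h2 := phaseStart_phaseIndex_le (m := m) (k := k) (r := r) (k + n)
  have h3 := lt_phaseStart_phaseIndex_succ (r := r) hm0 hmk (k + n)
  rw [hΦ] at h2 h3
  refine ⟨Φ, h2, ?_⟩
  have h4 := phaseStart_add_mul m k r (Φ + 1)
  have h5 := Nat.div_mul_le_self Φ (r + 1)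
  have h6 : Φ / (r + 1) ≤ Φ := Nat.div_le_self _ _
  obtain ⟨I, hI⟩ : ∃ I, Φ = I + Φ / (r + 1) := ⟨Φ - Φ / (r + 1), by omega⟩
  rw [show Φ - Φ / (r + 1) = I by omega]
  rw [Nat.succ_div] at h4
  set h := Φ / (r + 1)
  -- Each home phase among the phases `1, …, Φ + 1` is charged to the `r = 2000 k` phases before it,
  -- which raises the size `m` of a phase to `m + 1/2000`. If the unfinished phase `Φ + 1` is itself
  -- a home phase, a full block precedes it; otherwise it accounts for the extra `2000 * m`.
  by_cases hd : r + 1 ∣ Φ + 1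
  · rw [if_pos hd] at h4
    have h7 : Φ + 1 = (r + 1) * (h + 1) := by
      have := Nat.succ_div_of_dvd hd
      rw [← this, Nat.mul_div_cancel' hd]
    have h8 : I = r * (h + 1) := by nlinarith
    have h9 : I = 2000 * (k * (h + 1)) := by rw [h8, hr]; ring
    nlinarith
  · rw [if_neg hd] at h4
    have h8 : 2000 * (k * h) ≤ I := by
      have : h * r ≤ I := by nlinarith
      calc 2000 * (k * h) = h * r := by rw [hr]; ring
        _ ≤ I := this
    nlinarith

theorem mainTheorem2 (k α : ℕ) (hα : 4 ≤ α) (hαk : α < 2 * k) :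
    ∃ (V : Type) (_ : Fintype V) (M : WeightedGraph V) (s₀ : Fin k → V),
      M.graph.treewidth = α ∧ Function.Injective s₀ ∧
      ∀ n : ℕ, 4 * k ≤ n → ∀ (A : OnlineAlgorithm V k) (b : ℕ),
        A.IsOptimalWithAdvice M s₀ n b →
          (n : ℝ) / 2 * (Real.logb 2 (α : ℝ) - 1.22) ≤ (b : ℝ) := by
  -- Each label needs two of the `α + 1` hubs. The choice `r = 2000 * k` below is even, as the
  -- return home requires, and large enough to make the home phases negligible.
  obtain ⟨m, hm⟩ : ∃ m, m = (α + 1) / 2 := ⟨_, rfl⟩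
  have : NeZero k := ⟨by omega⟩
  have hm0 : 0 < m := by omega
  have hmk : m ≤ k := by omega
  have hmα : 2 * m ≤ α + 1 := by omega
  have hr : 0 < 2000 * k := by omega
  refine ⟨_, inferInstance, phaseGraph m k (2000 * k) α hmα hr, homeConfig m k (2000 * k) α,
    phaseGraph_treewidth hmα (by omega) hr, homeConfig_injective, fun n hn A b hA => ?_⟩
  obtain ⟨Φ, hΦ, hcount⟩ := exists_phase_count (n := n) hm0 hmk
  have hpow := factorial_pow_le_two_pow hm0 hmk hmα (by omega) ⟨1000 * k, by omega⟩ hr A hΦ hA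
  set I := Φ - Φ / (2000 * k + 1)
  have hL0 : 0 ≤ Real.logb 2 m.factorial :=
    Real.logb_nonneg one_lt_two (by exact_mod_cast m.factorial_pos)
  have hIb : I * Real.logb 2 m.factorial ≤ b := logb_two_le_of_pow_le m.factorial_pos hpow
  have harith := advice_arithmetic hα hαk hm hn
  have hcount' : 2000 * ((n : ℝ) + 1 - m) ≤ (2000 * m + 1) * I := by
    have : (2000 * (n + 1) : ℝ) ≤ (2000 * m + 1) * I + 2000 * m := by exact_mod_cast hcount
    linarith
  have h1 := mul_le_mul_of_nonneg_right hcount' hL0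
  have h2 := mul_le_mul_of_nonneg_left hIb (by positivity : (0 : ℝ) ≤ 2000 * m + 1)
  refine le_of_mul_le_mul_left (a := 2000 * (m : ℝ) + 1) ?_ (by positivity)
  linarith
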